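/- **Conventions.** Let $\lambda\ge 0$, let $\eta\ge 1$ and $0<\alpha_1<\dots<\alpha_\lambda<\eta$ be integers with $\alpha_i=\eta-\alpha_{\lambda+1-i}$ for $1\le i\le\lambda$, and let $k,r$ be integers with $k>r\ge\lambda\ge 0$ and $k-1>\lambda$. An overpartition is a finite non-increasing sequence $\pi=(\pi_1,\dots,\pi_\ell)$ of positive integers, each possibly overlined, with respect to the order $\bar1<1<\bar2<2<\cdots$, in which each overlined part $\bar t$ occurs at most once; the empty sequence is allowed. Write $\ell(\pi)$ for the number of parts, $|\pi_i|$ for the size of a part, $|\pi|=\sum_i|\pi_i|$, and $\pi_i+b$ for the part of size $|\pi_i|+b$ that is overlined iff $\pi_i$ is. A part is divisible by $\eta$ if its size is. An unbarred integer in a comparison of parts denotes a non-overlined part. Let $f_{\le\eta}(\pi)$ be the number of parts $\le\eta$; let $\overline V_\pi(p)$ be the number of overlined parts $\le p$ of $\pi$ not divisible by $\eta$, and $\overline O_\pi(p)$ the number of overlined parts $\ge p$ of $\pi$ divisible by $\eta$. For $m\ge1$, consecutive parts $\pi_i,\dots,\pi_{i+m-1}$ form an $m$-band if $\pi_i\le\pi_{i+m-1}+\eta$,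 with strict inequality if $\pi_i$ is overlined. **The sets.** - $\overline{\mathcal B}(\alpha_1,\dots,\alpha_\lambda;\eta,k,r)$ is the set of overpartitions $\pi$ such that all $|\pi_i|\equiv 0,\alpha_1,\dots,\alpha_\lambda\pmod\eta$; all non-overlined parts are divisible by $\eta$; $\pi_i\ge\pi_{i+k-1}+\eta$ for $1\le i\le\ell-k+1$, with strict inequality if $\pi_i$ is non-overlined; and $f_{\le\eta}(\pi)\le r$. - $\overline{\mathcal B}_0(\alpha_1,\dots,\alpha_\lambda;\eta,k,r)$ is the set of $\pi\in\overline{\mathcal B}(\alpha_1,\dots,\alpha_\lambda;\eta,k,r)$ such that (a) if $f_{\le\eta}(\pi)=r$ and $\overline\eta$ does not occur in $\pi$, then some $(k-1)$-band of $\pi$ has its first (largest) part $<\overline{2\eta}$; (b) every $(k-1)$-band satisfies $\left[|\pi_i|/\eta\right]+\dots+\left[|\pi_{i+k-2}|/\eta\right]\equiv r-1+\overline V_\pi(\pi_i)+\overline O_\pi(\pi_{i+k-2})\pmod 2$. - $\mathcal B_1(\alpha_1,\dots,\alpha_\lambda;\eta,k-1,r)$ is the set of $\pi\in\overline{\mathcal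 B}(\alpha_1,\dots,\alpha_\lambda;\eta,k-1,r)$ with no overlined part divisible by $\eta$ and with $f_{\le\eta}(\pi)\le r-1$. - $\mathcal D_\eta$ is the set of (possibly empty) partitions into distinct parts, all divisible by $\eta$. Let $s(\pi)$ be the smallest overlined part of $\pi$ divisible by $\eta$, and $g(\pi)$ the smallest part $\pi_i$ that is the first part of a $(k-1)$-band ($+\infty$ if there is none). For $t\ge1$, let $\overline{\mathcal B}{}_0^{=}(t)$ be the set of $\pi\in\overline{\mathcal B}_0(\alpha_1,\dots,\alpha_\lambda;\eta,k,r)$ with either $s(\pi)=\overline{t\eta}$ and $g(\pi)\ge\overline{t\eta}$, or $s(\pi)>\overline{t\eta}$ and $t\eta\le g(\pi)<\overline{(t+1)\eta}$; let $\overline{\mathcal B}{}_0^{>}(t)$ be the set of those with $s(\pi)>\overline{t\eta}$ and $g(\pi)\ge\overline{(t+1)\eta}$. **The operations.** The $(k-1)$-reduction $D_t$ removes from $\pi$ the part $\overline{t\eta}$ if $s(\pi)=\overline{t\eta}$, and otherwise one non-overlined part $t\eta$. For $k\ge3$, the $(k-1)$-augmentation $C_t$ inserts into $\mu$ a non-overlined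 part $t\eta$ if $\mu$ has a $(k-2)$-band $\mu_i,\dots,\mu_{i+k-3}$ with $\mu_{i+k-3}\ge(t-1)\eta$, $\mu_i<\overline{(t+1)\eta}$ and $\left[|\mu_i|/\eta\right]+\dots+\left[|\mu_{i+k-3}|/\eta\right]\equiv t+r-1+\overline V_\mu(\mu_i)+\overline O_\mu(\mu_{i+k-3})\pmod2$, and otherwise an overlined part $\overline{t\eta}$. The map $\Phi$ is defined as follows: start with $(\tau,\mu)=(\emptyset,\pi)$; as long as $\mu$ has a $(k-1)$-band or an overlined part divisible by $\eta$, put $t=\min\{[|s(\mu)|/\eta],[|g(\mu)|/\eta]\}$, replace $\mu$ by $D_t(\mu)$ and insert the part $t\eta$ into $\tau$. When this stops, $\Phi(\pi)=(\tau,\mu)$. **Theorem.** 1. For every $t\ge1$, $D_t$ is a bijection from $\overline{\mathcal B}{}_0^{=}(t)$ onto $\overline{\mathcal B}{}_0^{>}(t)$, and $|D_t(\pi)|=|\pi|-t\eta$, $\ell(D_t(\pi))=\ell(\pi)-1$ for every $\pi\in\overline{\mathcal B}{}_0^{=}(t)$. If $k\ge3$, then $C_t$ is a bijection from $\overline{\mathcal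 B}{}_0^{>}(t)$ onto $\overline{\mathcal B}{}_0^{=}(t)$, and $C_t$ and $D_t$ are inverse to each other. 2. $\Phi$ is a bijection from $\overline{\mathcal B}_0(\alpha_1,\dots,\alpha_\lambda;\eta,k,r)$ onto $\mathcal D_\eta\times\mathcal B_1(\alpha_1,\dots,\alpha_\lambda;\eta,k-1,r)$, and if $\Phi(\pi)=(\tau,\mu)$ then $|\pi|=|\tau|+|\mu|$ and $\ell(\pi)=\ell(\tau)+\ell(\mu)$. -/

import Mathlib

/-- A part of an overpartition: a size, together with the information whether it is overlined. -/
structure OPart where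
  size : ℕ
  overlined : Bool
deriving DecidableEq

namespace OPart

/-- Position of a part in the order `1̄ < 1 < 2̄ < 2 < ⋯`. -/
def key (p : OPart) : ℕ := 2 * p.size + (if p.overlined then 0 else 1)

theorem key_injective : Function.Injective key := by
  rintro ⟨a, x⟩ ⟨b, y⟩ h
  cases x <;> cases y <;> simp [key] at h ⊢ <;> omega

/-- The order `1̄ < 1 < 2̄ < 2 < ⋯` on parts. -/
instance : LinearOrder OPart := LinearOrder.lift' key key_injective

/-- `p + b`: the part of size `|p| + b` which is overlined iff `p` is. -/
def shift (p : OPart) (b : ℕ) : OPart := ⟨p.size + b, p.overlined⟩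

end OPart

namespace Overpartition

/-- The overlined part of size `n`. -/
def bar (n : ℕ) : OPart := ⟨n, true⟩

/-- The non-overlined part of size `n`. -/
def plain (n : ℕ) : OPart := ⟨n, false⟩

/-- A list of parts is an overpartition if it is non-increasing, all its parts are positive, and
each overlined part occurs at most once. (As `t̄ < t`, in a non-increasing list the overlined
occurrence of a size is the last one.) -/
def IsOverpartition (π : List OPart) : Prop :=
  π.Pairwise (· ≥ ·) ∧ (∀ p ∈ π, 0 < p.size) ∧ ∀ p ∈ π, p.overlined = true → π.count p = 1

/-- `|π|`, the sum of the sizes of the parts. The number of parts `ℓ(π)` is `π.length`. -/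
def weight (π : List OPart) : ℕ := (π.map OPart.size).sum

/-- `f_{≤ η}(π)`, the number of parts of `π` not exceeding the non-overlined part `η`. -/
def fLe (η : ℕ) (π : List OPart) : ℕ := π.countP (fun p => p ≤ plain η)

/-- `V̄_π(p)`: number of overlined parts of `π` not exceeding `p` and not divisible by `η`. -/
def barV (η : ℕ) (π : List OPart) (p : OPart) : ℕ :=
  π.countP (fun q => q.overlined = true ∧ q ≤ p ∧ ¬ η ∣ q.size)

/-- `Ō_π(p)`: number of overlined parts of `π` greater than or equal to `p` and divisible
by `η`. -/
def barO (η : ℕ) (π : List OPart) (p : OPart) : ℕ :=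
  π.countP (fun q => q.overlined = true ∧ p ≤ q ∧ η ∣ q.size)

/-- The `m` consecutive parts of `π` starting at (0-based) position `i` exist and form an
`m`-band: `π_i ≤ π_{i+m-1} + η`, with strict inequality if `π_i` is overlined. -/
def IsBand (η m : ℕ) (π : List OPart) (i : ℕ) : Prop :=
  ∃ (_ : 1 ≤ m) (_ : i + m ≤ π.length),
    π[i] ≤ (π[i + m - 1]).shift η ∧ (π[i].overlined = true → π[i] < (π[i + m - 1]).shift η)

instance (η m : ℕ) (π : List OPart) (i : ℕ) : Decidable (IsBand η m π i) := by
  unfold IsBand; infer_instance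

/-- The sum `[|π_i|/η] + ⋯ + [|π_{i+m-1}|/η]` over `m` consecutive parts. -/
def floorSum (η m : ℕ) (π : List OPart) (i : ℕ) : ℕ :=
  (((π.drop i).take m).map (fun p => p.size / η)).sum

/-- The `m` consecutive parts at position `i` exist, and
`[|π_i|/η] + ⋯ + [|π_{i+m-1}|/η] ≡ a + V̄_π(π_i) + Ō_π(π_{i+m-1}) (mod 2)`. -/
def BandCongr (η m : ℕ) (a : ℤ) (π : List OPart) (i : ℕ) : Prop :=
  ∃ (_ : 1 ≤ m) (_ : i + m ≤ π.length),
    (floorSum η m π i : ℤ) ≡ a + barV η π π[i] + barO η π π[i + m - 1] [ZMOD 2]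

instance (η m : ℕ) (a : ℤ) (π : List OPart) (i : ℕ) : Decidable (BandCongr η m a π i) := by
  unfold BandCongr Int.ModEq; infer_instance

/-- The set `B̄(α_1, …, α_λ; η, k, r)` (for `k ≥ 1`). -/
def setB {lam : ℕ} (α : Fin lam → ℕ) (η k r : ℕ) : Set (List OPart) :=
  {π | IsOverpartition π ∧
    (∀ p ∈ π, p.size ≡ 0 [MOD η] ∨ ∃ j, p.size ≡ α j [MOD η]) ∧
    (∀ p ∈ π, p.overlined = false → η ∣ p.size) ∧
    (∀ i, ∀ _ : i + (k - 1) < π.length,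
      (π[i + (k - 1)]).shift η ≤ π[i] ∧
        (π[i].overlined = false → (π[i + (k - 1)]).shift η < π[i])) ∧
    fLe η π ≤ r}

/-- The set `B̄_0(α_1, …, α_λ; η, k, r)`. -/
def setB0 {lam : ℕ} (α : Fin lam → ℕ) (η k r : ℕ) : Set (List OPart) :=
  {π | π ∈ setB α η k r ∧
    (fLe η π = r → bar η ∉ π →
      ∃ i, ∃ _ : i < π.length, π[i] < bar (2 * η) ∧ IsBand η (k - 1) π i) ∧
    ∀ i, IsBand η (k - 1) π i → BandCongr η (k - 1) ((r : ℤ) - 1) π i}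

/-- The set `B_1(α_1, …, α_λ; η, k, r)`; `fLe η π < r` is the condition `f_{≤ η}(π) ≤ r - 1`. -/
def setB1 {lam : ℕ} (α : Fin lam → ℕ) (η k r : ℕ) : Set (List OPart) :=
  {π | π ∈ setB α η k r ∧ (∀ p ∈ π, p.overlined = true → ¬ η ∣ p.size) ∧ fLe η π < r}

/-- The set `D_η` of partitions into distinct (positive) parts divisible by `η`. -/
def setD (η : ℕ) : Set (List ℕ) :=
  {τ | τ.Pairwise (· > ·) ∧ ∀ n ∈ τ, 0 < n ∧ η ∣ n}

/-- `s(π)`: the smallest overlined part of `π` divisible by `η`, or `∞` if there is none. -/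
def sPart (η : ℕ) (π : List OPart) : WithTop OPart :=
  (π.toFinset.filter (fun p => p.overlined = true ∧ η ∣ p.size)).inf (fun p => (p : WithTop OPart))

/-- `g(π)`: the smallest part `π_i` at which a `(k-1)`-band of `π` starts, or `∞` if there is
none. -/
def gPart (η k : ℕ) (π : List OPart) : WithTop OPart :=
  (Finset.univ.filter (fun i : Fin π.length => IsBand η (k - 1) π i)).inf
    (fun i => (π[i] : WithTop OPart))

/-- The subset `B̄_0^=(α_1, …, α_λ; η, k, r | t)`. -/
def setB0Eq {lam : ℕ} (α : Fin lam → ℕ) (η k r t : ℕ) : Set (List OPart) :=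
  {π | π ∈ setB0 α η k r ∧
    ((sPart η π = bar (t * η) ∧ (bar (t * η) : WithTop OPart) ≤ gPart η k π) ∨
      ((bar (t * η) : WithTop OPart) < sPart η π ∧ (plain (t * η) : WithTop OPart) ≤ gPart η k π ∧
        gPart η k π < (bar ((t + 1) * η) : WithTop OPart)))}

/-- The subset `B̄_0^>(α_1, …, α_λ; η, k, r | t)`. -/
def setB0Gt {lam : ℕ} (α : Fin lam → ℕ) (η k r t : ℕ) : Set (List OPart) :=
  {π | π ∈ setB0 α η k r ∧ (bar (t * η) : WithTop OPart) < sPart η π ∧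
    (bar ((t + 1) * η) : WithTop OPart) ≤ gPart η k π}

/-- The `(k-1)`-reduction `D_t`: remove the overlined part `tη` if it is `s(π)`, and otherwise
remove one non-overlined part `tη`. -/
def reduction (η t : ℕ) (π : List OPart) : List OPart :=
  if sPart η π = bar (t * η) then π.erase (bar (t * η)) else π.erase (plain (t * η))

/-- The `(k-1)`-augmentation `C_t`: insert a non-overlined part `tη` if there is a `(k-2)`-band of
`μ` belonging to `[(t-1)η, \overline{(t+1)η})` which is of type `N`, and otherwise insert an
overlined part `tη`. -/
def augmentation (η k r t : ℕ) (μ : List OPart) : List OPart :=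
  if ∃ i : Fin μ.length, IsBand η (k - 2) μ i ∧
      (∃ _ : i + (k - 2) - 1 < μ.length, plain ((t - 1) * η) ≤ μ[i + (k - 2) - 1]) ∧
      μ[i] < bar ((t + 1) * η) ∧ BandCongr η (k - 2) ((t : ℤ) + r - 1) μ i
  then μ.orderedInsert (· ≥ ·) (plain (t * η))
  else μ.orderedInsert (· ≥ ·) (bar (t * η))

/-- `min {[|s(π)|/η], [|g(π)|/η]}`, which is `∞` exactly if `π` has neither overlined parts
divisible by `η` nor `(k-1)`-bands. -/
def reductionIndex (η k : ℕ) (π : List OPart) : WithTop ℕ :=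
  min ((sPart η π).map (fun p => p.size / η)) ((gPart η k π).map (fun p => p.size / η))

/-- One round of the procedure defining `Φ`: with `t = min {[|s(π)|/η], [|g(π)|/η]}`, apply the
reduction `D_t` to `π` and insert the part `tη` into `τ`; if `t = ∞`, nothing changes any more. -/
def reductionStep (η k : ℕ) (x : List ℕ × List OPart) : List ℕ × List OPart :=
  match reductionIndex η k x.2 with
  | none => x
  | some t => (x.1.orderedInsert (· ≥ ·) (t * η), reduction η t x.2)

/-- The map `Φ`: starting with `(∅, π)`, reduce repeatedly until there is nothing left to reduce.
As every reduction removes a part, `ℓ(π)` rounds are enough. -/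
def Phi (η k : ℕ) (π : List OPart) : List ℕ × List OPart :=
  (reductionStep η k)^[π.length] ([], π)

end Overpartition

/-! Put K = k - 1. Parts that can lie in one band with smallest part q form a window, and a K-band
starting below c exists iff some window has at least K parts below c (`exists_isBand_iff`). Window
sizes do not depend on positions, so the effect of adding or removing one part can be read off. The
difference condition says that no window exceeds K.

The congruence loses its dependence on positions too. For an m-band between sη and overlined (s+2)η,
the floor sum minus V̄ minus Ō has a parity depending only on π, s and m, the type `typ`, provided
that no window below overlined (s+2)η exceeds m (`bandCongr_iff_typ`).

Let t = s+1. Inserting a non-overlined tη flips type s; inserting an overlined one keeps it. If the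
insertion creates a K-band below overlined (t+1)η, exactly one choice gives the right parity. If it
creates none, only an overlined part can be detected later, through s(π). This rule, `InsertsPlain`,
makes `insertPart` the inverse of D_t. The hypothesis λ < K is needed because a window has at most λ
parts not divisible by η: every K-band contains a multiple of η, and when D_t has to remove a
non-overlined tη, that part is present (`plain_mem_of_isBand`).

The source of D_t consists of the elements of B̄_0 with reduction index t, its target of those with
larger index. Hence Φ records strictly increasing t and stops at index ∞, which characterises B_1.
Reinserting the recorded parts, largest first, inverts Φ. -/

namespace OPart

/-! ### Comparing parts through numerical keys -/

theorem le_iff_key (p q : OPart) : p ≤ q ↔ p.key ≤ q.key := Iff.rfl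

theorem lt_iff_key (p q : OPart) : p < q ↔ p.key < q.key := by
  rw [lt_iff_not_ge, le_iff_key, not_le]

@[simp] theorem key_shift (p : OPart) (b : ℕ) : (p.shift b).key = p.key + 2 * b := by
  rcases p with ⟨a, _ | _⟩ <;> simp [key, shift] <;> omega

theorem key_of_overlined {p : OPart} (h : p.overlined = true) : p.key = 2 * p.size := by
  simp [key, h]

end OPart

namespace Overpartition
open OPart

@[simp] theorem key_bar (n : ℕ) : (bar n).key = 2 * n := rfl

@[simp] theorem key_plain (n : ℕ) : (plain n).key = 2 * n + 1 := rfl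

@[simp] theorem size_bar (n : ℕ) : (bar n).size = n := rfl

@[simp] theorem size_plain (n : ℕ) : (plain n).size = n := rfl

@[simp] theorem overlined_bar (n : ℕ) : (bar n).overlined = true := rfl

@[simp] theorem overlined_plain (n : ℕ) : (plain n).overlined = false := rfl

theorem eq_bar_iff {p : OPart} {n : ℕ} : p = bar n ↔ p.overlined = true ∧ p.size = n := by
  rcases p with ⟨a, _ | _⟩ <;> simp [bar]

theorem eq_plain_iff {p : OPart} {n : ℕ} : p = plain n ↔ p.overlined = false ∧ p.size = n := by
  rcases p with ⟨a, _ | _⟩ <;> simp [plain]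

/-! ### Bands as windows -/

/-- The largest part `p` and the smallest part `q` of a band are related in this way. -/
def Fits (η : ℕ) (p q : OPart) : Prop :=
  p ≤ q.shift η ∧ (p.overlined = true → p < q.shift η)

instance (η : ℕ) (p q : OPart) : Decidable (Fits η p q) := by
  unfold Fits; infer_instance

theorem fits_iff {η : ℕ} {p q : OPart} :
    Fits η p q ↔ p.key < q.key + 2 * η ∨ (p.overlined = false ∧ p.key = q.key + 2 * η) := by
  unfold Fits
  rw [le_iff_key, lt_iff_key, key_shift]
  cases p.overlined <;> simp <;> omega

theorem Fits.mono {η : ℕ} {p q p' q' : OPart} (h : Fits η p q) (hp : p' ≤ p) (hq : q ≤ q') :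
    Fits η p' q' := by
  by_cases e : p' = p
  · subst e
    rw [fits_iff] at *
    rw [le_iff_key] at hq
    rcases h with h | h
    · left; omega
    · rcases hq.lt_or_eq with h' | h'
      · left; omega
      · right; exact ⟨h.1, by omega⟩
  · have := lt_of_le_of_ne hp e
    rw [fits_iff] at *
    rw [le_iff_key] at hq
    rw [lt_iff_key] at this
    left; omega

/-- The number of parts of `π` which are smaller than `c` and may belong to a band with smallest
part `q`. -/
def win (η : ℕ) (c : WithTop OPart) (q : OPart) (π : List OPart) : ℕ :=
  π.countP (fun p => q ≤ p ∧ Fits η p q ∧ (p : WithTop OPart) < c)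

theorem win_perm {η : ℕ} {c : WithTop OPart} {q : OPart} {π μ : List OPart} (h : π.Perm μ) :
    win η c q π = win η c q μ := h.countP_eq _

theorem win_cons (η : ℕ) (c : WithTop OPart) (q x : OPart) (π : List OPart) :
    win η c q (x :: π) =
      win η c q π + if q ≤ x ∧ Fits η x q ∧ (x : WithTop OPart) < c then 1 else 0 := by
  simp [win, List.countP_cons]

theorem win_le_of_imp {η : ℕ} {c c' : WithTop OPart} {q q' : OPart} {π : List OPart}
    (h : ∀ p ∈ π, q ≤ p → Fits η p q → (p : WithTop OPart) < c →
      q' ≤ p ∧ Fits η p q' ∧ (p : WithTop OPart) < c') :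
    win η c q π ≤ win η c' q' π := by
  unfold win
  apply List.countP_mono_left
  intro p hp
  simp only [decide_eq_true_eq]
  exact fun h' => h p hp h'.1 h'.2.1 h'.2.2

theorem win_mono {η : ℕ} {c c' : WithTop OPart} (h : c ≤ c') (q : OPart) (π : List OPart) :
    win η c q π ≤ win η c' q π :=
  win_le_of_imp fun _ _ h1 h2 h3 => ⟨h1, h2, h3.trans_le h⟩

theorem isBand_iff {η m : ℕ} {π : List OPart} {i : ℕ} :
    IsBand η m π i ↔ ∃ (_ : 1 ≤ m) (_ : i + m ≤ π.length), Fits η π[i] π[i + m - 1] := Iff.rfl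

theorem le_getElem_of_le_countP {q : OPart} : ∀ {π : List OPart} {n : ℕ},
    π.Pairwise (· ≥ ·) → n < π.countP (fun p => q ≤ p) → ∃ h : n < π.length, q ≤ π[n] := by
  intro π
  induction π with
  | nil => intro n _ h; simp at h
  | cons a π ih =>
    intro n hs h
    rw [List.pairwise_cons] at hs
    rw [List.countP_cons] at h
    cases n with
    | zero =>
      refine ⟨by simp, ?_⟩
      simp only [List.getElem_cons_zero]
      by_contra hq
      rw [if_neg (by simpa using hq)] at h
      obtain ⟨x, hx, hx'⟩ := List.countP_pos_iff.1 (by omega : 0 < π.countP (fun p => q ≤ p))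
      exact hq (le_trans (by simpa using hx') (hs.1 x hx))
    | succ n =>
      obtain ⟨h1, h2⟩ := @ih n hs.2 (by split_ifs at h <;> omega)
      exact ⟨by simpa using h1, by simpa using h2⟩

/-- Leading parts are dropped as long as the tail still has m parts in the window. Then the head
lies in the window, and since the parts that are at least q form an initial segment, the first m
parts are a band. -/
theorem exists_isBand_of_le_win {η m : ℕ} {c : WithTop OPart} {q : OPart} (hm : 1 ≤ m) :
    ∀ {π : List OPart}, π.Pairwise (· ≥ ·) → m ≤ win η c q π →
      ∃ i, ∃ _ : i + m ≤ π.length, IsBand η m π i ∧ (π[i] : WithTop OPart) < c ∧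
        q ≤ π[i + m - 1] := by
  intro π
  induction π with
  | nil => intro _ h; simp [win] at h; omega
  | cons a π ih =>
    intro hs h
    by_cases h' : m ≤ win η c q π
    · obtain ⟨i, hi, ⟨_, _, h1⟩, h2, h3⟩ := ih (List.pairwise_cons.1 hs).2 h'
      have e : i + 1 + m - 1 = (i + m - 1) + 1 := by omega
      refine ⟨i + 1, by simp; omega, ⟨hm, by simp; omega, ?_⟩, ?_, ?_⟩
      · simpa [e] using h1
      · simpa using h2
      · simpa [e] using h3
    · rw [win_cons] at h
      split_ifs at h with ha
      swap
      · omega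
      obtain ⟨ha1, ha2, ha3⟩ := ha
      have hle : win η c q (a :: π) ≤ (a :: π).countP (fun p => q ≤ p) := by
        apply List.countP_mono_left
        intro p _ hp
        simp only [decide_eq_true_eq] at hp ⊢
        exact hp.1
      have hw : m ≤ win η c q (a :: π) := by
        rw [win_cons, if_pos ⟨ha1, ha2, ha3⟩]; omega
      obtain ⟨h1, h2⟩ := le_getElem_of_le_countP (q := q) (n := m - 1) hs (by omega)
      have e : 0 + m - 1 = m - 1 := by omega
      refine ⟨0, by omega, ⟨hm, by omega, ?_⟩, by simpa using ha3, by simpa [e] using h2⟩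
      have := ha2.mono le_rfl h2
      simpa [e, Fits] using this

/-- A band splits the list of parts. -/
theorem IsBand.exists_split {η m : ℕ} {π : List OPart} {i : ℕ} (hs : π.Pairwise (· ≥ ·))
    (h : IsBand η m π i) (h0 : i < π.length) (h1 : i + m - 1 < π.length) :
    ∃ L B R, π = L ++ B ++ R ∧ B = (π.drop i).take m ∧ B.length = m ∧
      (∀ p ∈ L, π[i] ≤ p) ∧ (∀ p ∈ B, π[i + m - 1] ≤ p ∧ p ≤ π[i]) ∧
      (∀ p ∈ R, p ≤ π[i + m - 1]) := by
  obtain ⟨hm, hi, -⟩ := h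
  have mono : ∀ a b (_ : a < π.length) (_ : b < π.length), a ≤ b → π[b] ≤ π[a] := by
    intro a b ha hb hab
    rcases hab.lt_or_eq with h | h
    · exact List.pairwise_iff_getElem.1 hs a b ha hb h
    · subst h; exact le_rfl
  refine ⟨π.take i, (π.drop i).take m, (π.drop i).drop m, ?_, rfl, by simp; omega, ?_, ?_, ?_⟩
  · rw [List.append_assoc, List.take_append_drop, List.take_append_drop]
  · intro p hp
    obtain ⟨j, hj, rfl⟩ := List.getElem_of_mem hp
    simp at hj
    simp only [List.getElem_take]
    exact mono _ _ _ _ (by omega)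
  · intro p hp
    obtain ⟨j, hj, rfl⟩ := List.getElem_of_mem hp
    simp at hj
    simp only [List.getElem_take, List.getElem_drop]
    exact ⟨mono _ _ _ _ (by omega), mono _ _ _ _ (by omega)⟩
  · intro p hp
    obtain ⟨j, hj, rfl⟩ := List.getElem_of_mem hp
    simp at hj
    simp only [List.getElem_drop]
    exact mono _ _ _ _ (by omega)

theorem IsBand.le_win {η m : ℕ} {c : WithTop OPart} {π : List OPart} {i : ℕ}
    (hs : π.Pairwise (· ≥ ·)) (h : IsBand η m π i) (h0 : i < π.length) (h1 : i + m - 1 < π.length)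
    (hc : (π[i] : WithTop OPart) < c) : m ≤ win η c π[i + m - 1] π := by
  obtain ⟨L, B, R, e, -, hB, -, hB', -⟩ := h.exists_split hs h0 h1
  obtain ⟨_, _, hf⟩ := isBand_iff.1 h
  have : B.countP (fun p => π[i + m - 1] ≤ p ∧ Fits η p π[i + m - 1] ∧ (p : WithTop OPart) < c)
      = m := by
    refine (List.countP_eq_length.2 ?_).trans hB
    intro p hp
    simp only [decide_eq_true_eq]
    exact ⟨(hB' p hp).1, hf.mono (hB' p hp).2 le_rfl,
      (WithTop.coe_le_coe.2 (hB' p hp).2).trans_lt hc⟩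
  unfold win
  generalize π[i + m - 1] = q at this
  subst e
  simp only [List.countP_append]
  omega

theorem exists_isBand_iff {η m : ℕ} {c : WithTop OPart} (hm : 1 ≤ m) {π : List OPart}
    (hs : π.Pairwise (· ≥ ·)) :
    (∃ i, ∃ _ : i < π.length, (π[i] : WithTop OPart) < c ∧ IsBand η m π i) ↔
      ∃ q, m ≤ win η c q π := by
  constructor
  · rintro ⟨i, hi, hc, hb⟩
    have ⟨_, h2, _⟩ := hb
    exact ⟨_, IsBand.le_win hs hb hi (by omega) hc⟩
  · rintro ⟨q, hq⟩
    obtain ⟨i, hi, h1, h2, -⟩ := exists_isBand_of_le_win hm hs hq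
    exact ⟨i, by omega, h2, h1⟩

/-! ### The type of a band -/

/-- Up to parity, the value of `floorSum - barV - barO` at an `m`-band whose parts lie between
`s η` and `(s + 2) η`. -/
def typ (η s m : ℕ) (π : List OPart) : ℤ :=
  s * m + π.countP (fun p => p = plain ((s + 1) * η)) +
    π.countP (fun p => p.overlined = true ∧ ¬ η ∣ p.size ∧ p.size < (s + 1) * η) +
    π.countP (fun p => p.overlined = true ∧ η ∣ p.size ∧ (s + 1) * η < p.size)

theorem le_or_le_of_dvd {η n : ℕ} (h : η ∣ n) (s : ℕ) : n ≤ s * η ∨ s * η + η ≤ n := by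
  obtain ⟨c, rfl⟩ := h
  rcases le_or_gt c s with h | h
  · left; rw [mul_comm]; exact Nat.mul_le_mul_right _ h
  · right
    have := Nat.mul_le_mul_right η (Nat.succ_le_of_lt h)
    rw [Nat.succ_mul] at this
    rwa [mul_comm η c]

/-- In a list, two counts that agree part by part agree. -/
theorem countP_add_countP_eq {f1 f2 g1 g2 g3 : OPart → Prop} [DecidablePred f1] [DecidablePred f2]
    [DecidablePred g1] [DecidablePred g2] [DecidablePred g3] {π : List OPart}
    (h : ∀ p ∈ π, (if f1 p then 1 else 0) + (if f2 p then 1 else 0) =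
      (if g1 p then 1 else 0) + (if g2 p then 1 else 0) + (if g3 p then 1 else 0)) :
    π.countP (fun p => f1 p) + π.countP (fun p => f2 p) =
      π.countP (fun p => g1 p) + π.countP (fun p => g2 p) + π.countP (fun p => g3 p) := by
  induction π with
  | nil => simp
  | cons a π ih =>
    simp only [List.countP_cons, decide_eq_true_eq]
    have h1 := h a (by simp)
    have h2 := ih fun p hp => h p (by simp [hp])
    omega

/-- Every quotient in this range is s or s + 1, with the jump at overlined (s+1)η. -/
theorem sum_floor_eq {η s : ℕ} : ∀ {B : List OPart},
    (∀ p ∈ B, plain (s * η) ≤ p ∧ p < bar ((s + 2) * η)) →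
    (B.map (fun p => p.size / η)).sum =
      s * B.length + B.countP (fun p => bar ((s + 1) * η) ≤ p) := by
  intro B
  induction B with
  | nil => simp
  | cons a B ih =>
    intro h
    have h1 := h a (by simp)
    have h2 := ih fun p hp => h p (by simp [hp])
    rw [le_iff_key, lt_iff_key, key_plain, key_bar] at h1
    simp only [List.map_cons, List.sum_cons, List.length_cons, List.countP_cons, h2,
      decide_eq_true_eq, le_iff_key, key_bar]
    have e1 : (s + 1) * η = s * η + η := by ring
    have e2 : (s + 2) * η = s * η + η + η := by ring
    rw [e2] at h1
    have hk : a.key = 2 * a.size ∨ a.key = 2 * a.size + 1 := by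
      unfold key; split_ifs <;> omega
    have : a.size / η = s + if 2 * ((s + 1) * η) ≤ a.key then 1 else 0 := by
      split_ifs with h'
      · rw [e1] at h'
        exact Nat.div_eq_of_lt_le (by rw [e1]; omega)
          (by rw [show (s + 1 + 1) * η = s * η + η + η by ring]; omega)
      · rw [e1] at h'
        exact Nat.div_eq_of_lt_le (by rw [add_zero]; omega) (by rw [add_zero, e1]; omega)
    rw [this]
    ring_nf

/-- An overlined (s+1)η contributes once to the floor sum and once to Ō, so it cancels; so do the
non-multiples of η in the band above (s+1)η, against V̄. What remains can be counted over all of π,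
because by `hex` the band fills its window. -/
theorem bandCongr_iff_typ {η m s : ℕ} {a : ℤ} {π : List OPart} {i : ℕ} (hη : 0 < η)
    (hs : π.Pairwise (· ≥ ·)) (hpl : ∀ p ∈ π, p.overlined = false → η ∣ p.size)
    (h : IsBand η m π i) (h0 : i < π.length) (h1 : i + m - 1 < π.length)
    (hlast : plain (s * η) ≤ π[i + m - 1]) (hfirst : π[i] < bar ((s + 2) * η))
    (hex : ∀ q, win η (bar ((s + 2) * η) : OPart) q π ≤ m) :
    BandCongr η m a π i ↔ typ η s m π ≡ a [ZMOD 2] := by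
  obtain ⟨hm, hi, hf⟩ := isBand_iff.1 h
  obtain ⟨L, B, R, e, hB, hBl, hL, hB', hR⟩ := h.exists_split hs h0 h1
  have hcong : BandCongr η m a π i ↔
      (floorSum η m π i : ℤ) ≡ a + barV η π π[i] + barO η π π[i + m - 1] [ZMOD 2] :=
    ⟨fun ⟨_, _, h⟩ => h, fun h => ⟨hm, hi, h⟩⟩
  rw [hcong]
  unfold floorSum
  rw [← hB]
  generalize π[i] = x at *
  generalize π[i + m - 1] = y at *
  have e1 : (s + 1) * η = s * η + η := by ring
  have e2 : (s + 2) * η = s * η + η + η := by ring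
  have hk : ∀ p : OPart, (p.overlined = true ∧ p.key = 2 * p.size) ∨
      (p.overlined = false ∧ p.key = 2 * p.size + 1) := by
    intro p; unfold key; cases p.overlined <;> simp
  have hwB : ∀ q, q ≤ y → Fits η x q →
      m ≤ B.countP (fun p => q ≤ p ∧ Fits η p q ∧
        (p : WithTop OPart) < (bar ((s + 2) * η) : OPart)) := by
    intro q hq hxq
    refine (hBl.symm.trans (List.countP_eq_length.2 ?_).symm).le
    intro p hp
    simp only [decide_eq_true_eq, WithTop.coe_lt_coe]
    exact ⟨hq.trans (hB' p hp).1, hxq.mono (hB' p hp).2 le_rfl, (hB' p hp).2.trans_lt hfirst⟩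
  -- A part of L or R fitting into the band's window would make m + 1 parts there, against `hex`.
  have hLout : ∀ p ∈ L, p < bar ((s + 2) * η) → ¬ Fits η p y := by
    intro p hp hp1 hp2
    have h1 := hex y
    have h2 := hwB y le_rfl hf
    have h3 : 0 < L.countP (fun p => y ≤ p ∧ Fits η p y ∧
        (p : WithTop OPart) < (bar ((s + 2) * η) : OPart)) := by
      refine List.countP_pos_iff.2 ⟨p, hp, ?_⟩
      simp only [decide_eq_true_eq, WithTop.coe_lt_coe]
      refine ⟨le_trans ?_ (hL p hp), hp2, hp1⟩
      obtain ⟨b, hb⟩ := List.exists_mem_of_length_pos (l := B) (by omega)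
      exact (hB' b hb).1.trans (hB' b hb).2
    simp only [win, e, List.countP_append] at h1
    omega
  have hRout : ∀ p ∈ R, ¬ Fits η x p := by
    intro p hp hp1
    have h1 := hex p
    have h2 := hwB p (hR p hp) hp1
    have hyx : y ≤ x := by
      obtain ⟨b, hb⟩ := List.exists_mem_of_length_pos (l := B) (by omega)
      exact (hB' b hb).1.trans (hB' b hb).2
    have h3 : 0 < R.countP (fun p' => p ≤ p' ∧ Fits η p' p ∧
        (p' : WithTop OPart) < (bar ((s + 2) * η) : OPart)) := by
      refine List.countP_pos_iff.2 ⟨p, hp, ?_⟩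
      simp only [decide_eq_true_eq, WithTop.coe_lt_coe]
      have := (hR p hp).trans hyx
      exact ⟨le_rfl, hp1.mono this le_rfl, this.trans_lt hfirst⟩
    simp only [win, e, List.countP_append] at h1
    omega
  have hyx : y ≤ x := by
    obtain ⟨b, hb⟩ := List.exists_mem_of_length_pos (l := B) (by omega)
    exact (hB' b hb).1.trans (hB' b hb).2
  simp only [lt_iff_key, le_iff_key, fits_iff, key_bar, e2] at hLout hRout hyx
  simp only [lt_iff_key, le_iff_key, key_bar, key_plain, e2] at hlast hfirst
  simp only [le_iff_key, fits_iff] at hL hB' hR hf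
  have hsum := sum_floor_eq (η := η) (s := s) (B := B) (fun p hp => by
    have := hB' p hp
    simp only [lt_iff_key, le_iff_key, key_bar, key_plain, e2]
    omega)
  simp only [e, List.mem_append] at hpl
  have hdvd : ∀ p : OPart, η ∣ p.size → (p.size ≤ s * η ∨ s * η + η ≤ p.size) ∧
      (p.size ≤ s * η + η ∨ s * η + η + η ≤ p.size) := by
    intro p hp
    refine ⟨le_or_le_of_dvd hp s, ?_⟩
    have := le_or_le_of_dvd hp (s + 1)
    rwa [e1] at this
  have hndvd : ∀ p : OPart, ¬ η ∣ p.size → p.size ≠ s * η + η := by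
    rintro p hp h'
    exact hp ⟨s + 1, by rw [h', ← e1, mul_comm]⟩
  -- The floor sum and V̄ are compared with the counts in `typ` part by part, separately inside the
  -- band and on either side; then Ō is treated on the whole list.
  have cB : B.countP (fun p => bar ((s + 1) * η) ≤ p) +
      B.countP (fun p => p.overlined = true ∧ ¬ η ∣ p.size ∧ p.size < (s + 1) * η) =
      B.countP (fun p => p = plain ((s + 1) * η)) + B.countP (fun p => p = bar ((s + 1) * η)) +
      B.countP (fun p => p.overlined = true ∧ p ≤ x ∧ ¬ η ∣ p.size) := by
    apply countP_add_countP_eq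
    intro p hp
    have h1 := hB' p hp
    have h2 := hpl p (by simp [hp])
    simp only [eq_plain_iff, eq_bar_iff, le_iff_key, key_bar, e1]
    rcases hk p with ⟨hp1, hp2⟩ | ⟨hp1, hp2⟩ <;> by_cases hd : η ∣ p.size
    · have := hdvd p hd
      simp only [hp1, hd, hp2] at h1 ⊢
      simp
      split_ifs <;> omega
    · have := hndvd p hd
      simp only [hp1, hd, hp2] at h1 ⊢
      simp
      split_ifs <;> omega
    · have := hdvd p hd
      simp only [hp1, hd, hp2] at h1 ⊢
      simp
      split_ifs <;> omega
    · exact absurd (h2 hp1) hd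
  have cL : L.countP (fun _ => False) +
      L.countP (fun p => p.overlined = true ∧ ¬ η ∣ p.size ∧ p.size < (s + 1) * η) =
      L.countP (fun p => p = plain ((s + 1) * η)) + L.countP (fun p => p = bar ((s + 1) * η)) +
      L.countP (fun p => p.overlined = true ∧ p ≤ x ∧ ¬ η ∣ p.size) := by
    apply countP_add_countP_eq
    intro p hp
    have h1 := hL p hp
    have h2 := hpl p (by simp [hp])
    have h3 := hLout p hp
    simp only [eq_plain_iff, eq_bar_iff, le_iff_key, e1]
    rcases hk p with ⟨hp1, hp2⟩ | ⟨hp1, hp2⟩ <;> by_cases hd : η ∣ p.size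
    · simp only [hp1, hd, hp2] at h1 h3 ⊢
      simp at h3 ⊢
      omega
    · have := hndvd p hd
      simp only [hp1, hd, hp2] at h1 h3 ⊢
      simp at h3 ⊢
      rcases hk x with ⟨hx1, hx2⟩ | ⟨hx1, hx2⟩ <;> simp [hx1] at hf <;> split_ifs <;> omega
    · simp only [hp1, hd, hp2] at h1 h3 ⊢
      simp at h3 ⊢
      omega
    · exact absurd (h2 hp1) hd
  have cR : R.countP (fun _ => False) +
      R.countP (fun p => p.overlined = true ∧ ¬ η ∣ p.size ∧ p.size < (s + 1) * η) =
      R.countP (fun p => p = plain ((s + 1) * η)) + R.countP (fun p => p = bar ((s + 1) * η)) +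
      R.countP (fun p => p.overlined = true ∧ p ≤ x ∧ ¬ η ∣ p.size) := by
    apply countP_add_countP_eq
    intro p hp
    have h1 := hR p hp
    have h3 := hRout p hp
    simp only [eq_plain_iff, eq_bar_iff, le_iff_key, e1]
    rcases hk p with ⟨hp1, hp2⟩ | ⟨hp1, hp2⟩ <;> by_cases hd : η ∣ p.size
    all_goals
      simp only [hp1, hd, hp2] at h1 h3 ⊢
      simp at h3 ⊢
      try split_ifs
    all_goals omega
  have cO : (L ++ B ++ R).countP (fun p => p.overlined = true ∧ y ≤ p ∧ η ∣ p.size) +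
      (L ++ B ++ R).countP (fun _ => False) =
      (L ++ B ++ R).countP (fun p => p.overlined = true ∧ η ∣ p.size ∧ (s + 1) * η < p.size) +
      (L ++ B ++ R).countP (fun p => p = bar ((s + 1) * η)) +
      (L ++ B ++ R).countP (fun _ => False) := by
    apply countP_add_countP_eq
    intro p hp
    have h1 : y.key ≤ p.key ∨ p ∈ R := by
      simp only [List.mem_append] at hp
      rcases hp with (hp | hp) | hp
      · exact Or.inl (hyx.trans (hL p hp))
      · exact Or.inl (hB' p hp).1
      · exact Or.inr hp
    have h3 : p ∈ R → p.key ≤ y.key ∧ x.key ≥ p.key + 2 * η := by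
      intro hp
      have := hRout p hp
      have := hR p hp
      omega
    simp only [eq_bar_iff, le_iff_key, e1]
    rcases hk p with ⟨hp1, hp2⟩ | ⟨hp1, hp2⟩ <;> by_cases hd : η ∣ p.size
    · have := hdvd p hd
      simp only [hp1, hd, hp2] at h1 h3 ⊢
      simp at h3 ⊢
      rcases h1 with h1 | h1
      · split_ifs <;> omega
      · have := h3 h1
        split_ifs <;> omega
    · have := hndvd p hd
      simp [hd, this]
    · simp [hp1]
    · simp [hp1]
  subst e
  unfold typ barV barO
  rw [hsum]
  simp only [List.countP_append, decide_false, List.countP_false, Function.const_apply] at cB cL cR cO ⊢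
  simp only [Int.ModEq, hBl] at *
  push_cast
  omega
-- The sets in terms of windows and types
/-- The conditions in `setB` on the single parts. -/
def Admissible {lam : ℕ} (α : Fin lam → ℕ) (η : ℕ) (π : List OPart) : Prop :=
  IsOverpartition π ∧
    (∀ p ∈ π, p.size ≡ 0 [MOD η] ∨ ∃ j, p.size ≡ α j [MOD η]) ∧
    (∀ p ∈ π, p.overlined = false → η ∣ p.size)

theorem key_cases (p : OPart) : (p.overlined = true ∧ p.key = 2 * p.size) ∨
    (p.overlined = false ∧ p.key = 2 * p.size + 1) := by
  unfold key; cases p.overlined <;> simp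

/-- A window contains at most `lam` parts that are not divisible by `η`. -/
theorem Admissible.countP_le {lam : ℕ} {α : Fin lam → ℕ} {η : ℕ} {π : List OPart}
    (h : Admissible α η π) (q : OPart) (P : OPart → Prop) [DecidablePred P]
    (hP : ∀ p ∈ π, P p → q ≤ p ∧ Fits η p q ∧ ¬ η ∣ p.size) :
    π.countP (fun p => P p) ≤ lam := by
  obtain ⟨⟨-, -, hov⟩, hres, hpl⟩ := h
  have hov' : ∀ p ∈ π, P p → p.overlined = true := by
    intro p hp hPp
    by_contra hc
    exact (hP p hp hPp).2.2 (hpl p hp (by simpa using hc))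
  have hnd : (π.filter (fun p => P p)).Nodup := by
    rw [List.nodup_iff_count_le_one]
    intro a
    by_cases ha : a ∈ π ∧ P a
    · exact (List.filter_sublist.count_le a).trans (hov a ha.1 (hov' a ha.1 ha.2)).le
    · rw [List.count_eq_zero_of_not_mem (by simpa [List.mem_filter] using ha)]
      omega
  rw [List.countP_eq_length_filter, ← List.toFinset_card_of_nodup hnd]
  have hle : ((π.filter (fun p => P p)).toFinset.image (fun p => p.size % η)).card ≤ lam := by
    refine (Finset.card_le_card (t := Finset.univ.image (fun j => α j % η)) ?_).trans
      (Finset.card_image_le.trans (by simp))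
    intro n hn
    simp only [Finset.mem_image, List.mem_toFinset, List.mem_filter, decide_eq_true_eq] at hn
    obtain ⟨p, ⟨hp, hPp⟩, rfl⟩ := hn
    rcases hres p hp with h0 | ⟨j, hj⟩
    · exact absurd (Nat.modEq_zero_iff_dvd.1 h0) (hP p hp hPp).2.2
    · simp only [Finset.mem_image, Finset.mem_univ, true_and]
      exact ⟨j, hj.symm⟩
  rwa [Finset.card_image_of_injOn] at hle
  -- Overlined parts in a common window differ in size by less than η, so equal residues force
  -- equality.
  have key : ∀ a b : OPart, a ∈ π → P a → b ∈ π → P b → a.size % η = b.size % η →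
      a.size ≤ b.size → a = b := by
    intro a b ha hPa hb hPb hab hle
    have oa := hov' a ha hPa
    have ob := hov' b hb hPb
    have ka := hP a ha hPa
    have kb := hP b hb hPb
    rw [le_iff_key, fits_iff, key_of_overlined oa] at ka
    rw [le_iff_key, fits_iff, key_of_overlined ob] at kb
    simp only [oa, ob] at ka kb
    have hlt : b.size - a.size < η := by
      simp at ka kb
      omega
    have hd : η ∣ b.size - a.size := (Nat.modEq_iff_dvd' hle).1 hab
    have := Nat.eq_zero_of_dvd_of_lt hd hlt
    apply key_injective
    rw [key_of_overlined oa, key_of_overlined ob]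
    omega
  intro a ha b hb hab
  simp only [Finset.mem_coe, List.mem_toFinset, List.mem_filter, decide_eq_true_eq] at ha hb hab
  rcases le_total a.size b.size with hl | hl
  · exact key a b ha.1 ha.2 hb.1 hb.2 hab hl
  · exact (key b a hb.1 hb.2 ha.1 ha.2 hab.symm hl).symm

/-- The difference condition at distance K says precisely that there is no (K+1)-band. -/
theorem not_isBand_iff_win {η K : ℕ} {π : List OPart} (hs : π.Pairwise (· ≥ ·)) :
    (∀ i, ∀ _ : i + K < π.length,
      (π[i + K]).shift η ≤ π[i] ∧
        (π[i].overlined = false → (π[i + K]).shift η < π[i])) ↔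
      ∀ q, win η ⊤ q π ≤ K := by
  have h1 : (∀ q, win η ⊤ q π ≤ K) ↔ ¬ ∃ q, K + 1 ≤ win η ⊤ q π := by
    push Not
    exact forall_congr' fun q => by omega
  rw [h1, ← exists_isBand_iff (by omega) hs]
  push Not
  refine forall_congr' fun i => ⟨fun h hi _ hb => ?_, fun h hi => ?_⟩
  · obtain ⟨_, h3, h4⟩ := isBand_iff.1 hb
    have := h (by omega)
    rw [fits_iff] at h4
    rw [le_iff_key, lt_iff_key, key_shift] at this
    simp only [← Nat.add_assoc, Nat.add_sub_cancel] at h4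
    cases hov : π[i].overlined <;> simp [hov] at h4 this <;> omega
  · have := h (by omega) (WithTop.coe_lt_top _)
    have h4 : ¬ Fits η π[i] π[i + K] := by
      intro h4
      exact this (isBand_iff.2 ⟨by omega, by omega, h4⟩)
    rw [fits_iff] at h4
    rw [le_iff_key, lt_iff_key, key_shift]
    cases hov : π[i].overlined <;> simp [hov] at h4 ⊢ <;> omega

theorem mem_setB_iff {lam : ℕ} {α : Fin lam → ℕ} {η K r : ℕ} {π : List OPart} :
    π ∈ setB α η (K + 1) r ↔
      Admissible α η π ∧ (∀ q, win η ⊤ q π ≤ K) ∧ fLe η π ≤ r := by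
  constructor
  · rintro ⟨h1, h2, h3, h4, h5⟩
    exact ⟨⟨h1, h2, h3⟩, (not_isBand_iff_win h1.1).1 h4, h5⟩
  · rintro ⟨⟨h1, h2, h3⟩, h4, h5⟩
    exact ⟨h1, h2, h3, (not_isBand_iff_win h1.1).2 h4, h5⟩

theorem le_gPart_iff {η K : ℕ} (hK : 1 ≤ K) {π : List OPart} (hs : π.Pairwise (· ≥ ·))
    (c : WithTop OPart) : c ≤ gPart η (K + 1) π ↔ ∀ q, win η c q π < K := by
  have h1 : (∀ q, win η c q π < K) ↔ ¬ ∃ q, K ≤ win η c q π := by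
    push Not
    rfl
  rw [h1, ← exists_isBand_iff hK hs, gPart, Finset.le_inf_iff]
  push Not
  simp only [Finset.mem_filter, Finset.mem_univ, true_and, Nat.add_sub_cancel]
  constructor
  · intro h i hi hc hb
    exact (h ⟨i, hi⟩ hb).not_gt hc
  · intro h i hb
    by_contra hc
    exact h i.1 i.2 (not_le.1 hc) hb

theorem gPart_lt_iff {η K : ℕ} (hK : 1 ≤ K) {π : List OPart} (hs : π.Pairwise (· ≥ ·))
    (c : WithTop OPart) : gPart η (K + 1) π < c ↔ ∃ q, K ≤ win η c q π := by
  rw [← not_le, le_gPart_iff hK hs]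
  push Not
  rfl

theorem bar_le_iff {n : ℕ} {p : OPart} : bar n ≤ p ↔ n ≤ p.size := by
  rw [le_iff_key, key_bar]
  have := key_cases p
  omega

theorem bar_lt_iff {n : ℕ} {p : OPart} (hp : p.overlined = true) : bar n < p ↔ n < p.size := by
  rw [lt_iff_key, key_bar, key_of_overlined hp]
  omega

theorem le_sPart_iff {η n : ℕ} {π : List OPart} :
    (bar n : WithTop OPart) ≤ sPart η π ↔
      ∀ p ∈ π, p.overlined = true → η ∣ p.size → n ≤ p.size := by
  rw [sPart, Finset.le_inf_iff]
  simp only [Finset.mem_filter, List.mem_toFinset, WithTop.coe_le_coe, bar_le_iff, and_imp]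

theorem lt_sPart_iff {η n : ℕ} {π : List OPart} :
    (bar n : WithTop OPart) < sPart η π ↔
      ∀ p ∈ π, p.overlined = true → η ∣ p.size → n < p.size := by
  rw [sPart, Finset.lt_inf_iff (WithTop.coe_lt_top _)]
  simp only [Finset.mem_filter, List.mem_toFinset, WithTop.coe_lt_coe, and_imp]
  exact forall₂_congr fun p _ => forall_congr' fun hp => by rw [bar_lt_iff hp]

theorem sPart_eq_iff {η n : ℕ} (hn : η ∣ n) {π : List OPart} :
    sPart η π = bar n ↔
      bar n ∈ π ∧ ∀ p ∈ π, p.overlined = true → η ∣ p.size → n ≤ p.size := by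
  rw [← le_sPart_iff]
  constructor
  · intro h
    refine ⟨?_, h.ge⟩
    by_contra hb
    have : (bar n : WithTop OPart) < sPart η π := by
      rw [lt_sPart_iff]
      intro p hp h1 h2
      refine lt_of_le_of_ne (le_sPart_iff.1 h.ge p hp h1 h2) ?_
      rintro rfl
      exact hb ((eq_bar_iff.2 ⟨h1, rfl⟩) ▸ hp)
    exact this.ne' h
  · rintro ⟨h1, h2⟩
    refine le_antisymm ?_ h2
    rw [sPart]
    exact Finset.inf_le (f := fun p : OPart => (p : WithTop OPart)) (by simp [h1, hn])

/-- A `K`-band with `K > lam` starts at a part of size at least `η`. -/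
theorem Admissible.win_bar_lt {lam : ℕ} {α : Fin lam → ℕ} {η K : ℕ} {π : List OPart}
    (h : Admissible α η π) (hK : lam < K) {q : OPart} : win η (bar η : OPart) q π < K := by
  refine lt_of_le_of_lt ?_ hK
  refine (win_mono le_rfl q π).trans (h.countP_le q _ ?_)
  rintro p hp ⟨h1, h2, h3⟩
  refine ⟨h1, h2, fun hd => ?_⟩
  rw [WithTop.coe_lt_coe, lt_iff_not_ge, bar_le_iff] at h3
  exact h3 (Nat.le_of_dvd (h.1.2.1 p hp) hd)

theorem typ_congr {η s m : ℕ} {π μ : List OPart} (h : π.Perm μ) : typ η s m π = typ η s m μ := by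
  unfold typ
  rw [h.countP_eq, h.countP_eq, h.countP_eq]

/-- The congruence condition on the bands with smallest part at least `s η` and largest part less
than the overlined part `(s + 2) η`. -/
def TypeCond (η K s : ℕ) (a : ℤ) (π : List OPart) : Prop :=
  ∀ q, plain (s * η) ≤ q → K ≤ win η (bar ((s + 2) * η) : OPart) q π → typ η s K π ≡ a [ZMOD 2]

/-- The ranges belonging to the various s cover all K-bands: take for s + 1 the quotient by η of the
first part, which is not 0 by `win_bar_lt`. -/
theorem forall_bandCongr_iff {lam : ℕ} {α : Fin lam → ℕ} {η K : ℕ} {a : ℤ} {π : List OPart}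
    (hη : 0 < η) (hK : lam < K) (h : Admissible α η π) (hw : ∀ q, win η ⊤ q π ≤ K) :
    (∀ i, IsBand η K π i → BandCongr η K a π i) ↔ ∀ s, TypeCond η K s a π := by
  have hs := h.1.1
  have hex : ∀ s q, win η (bar ((s + 2) * η) : OPart) q π ≤ K :=
    fun s q => (win_mono le_top q π).trans (hw q)
  constructor
  · intro H s q hq hKq
    obtain ⟨i, hi, h1, h2, h3⟩ := exists_isBand_of_le_win (by omega) hs hKq
    exact (bandCongr_iff_typ hη hs h.2.2 h1 (by omega) (by omega) (hq.trans h3)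
      (WithTop.coe_lt_coe.1 h2) (hex s)).1 (H i h1)
  · intro H i hb
    obtain ⟨_, hi, hf⟩ := isBand_iff.1 hb
    have h0 : i < π.length := by omega
    have h1 : i + K - 1 < π.length := by omega
    obtain ⟨s, hs1⟩ : ∃ s, π[i].size / η = s + 1 := by
      apply Nat.exists_eq_succ_of_ne_zero
      intro h0'
      have hlt : π[i] < bar η := by
        rw [lt_iff_not_ge, bar_le_iff]
        rcases Nat.div_eq_zero_iff.1 h0' with h | h <;> omega
      have h3 := hb.le_win hs h0 h1 (WithTop.coe_lt_coe.2 hlt)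
      have h4 := h.win_bar_lt hK (q := π[i + K - 1])
      omega
    have hb1 : (s + 1) * η ≤ π[i].size := (Nat.le_div_iff_mul_le hη).1 hs1.ge
    have hb2 : π[i].size < (s + 1 + 1) * η := (Nat.div_lt_iff_lt_mul hη).1 (by omega)
    have hfirst : π[i] < bar ((s + 2) * η) := by
      rw [lt_iff_not_ge, bar_le_iff]
      exact not_le.2 hb2
    -- An overlined first part fits strictly, which excludes an overlined sη as last part.
    have hlast : plain (s * η) ≤ π[i + K - 1] := by
      rw [fits_iff] at hf
      rw [le_iff_key, key_plain]
      have e1 : (s + 1) * η = s * η + η := by ring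
      have := key_cases π[i]
      have h5 := key_cases π[i + K - 1]
      rcases this with ⟨o, k⟩ | ⟨o, k⟩
      · simp [o] at hf
        omega
      · omega
    exact (bandCongr_iff_typ hη hs h.2.2 hb h0 h1 hlast hfirst (hex s)).2
      (H s _ hlast (hb.le_win hs h0 h1 (WithTop.coe_lt_coe.2 hfirst)))

theorem mem_setB0_iff {lam : ℕ} {α : Fin lam → ℕ} {η K r : ℕ} {π : List OPart}
    (hη : 0 < η) (hK : lam < K) :
    π ∈ setB0 α η (K + 1) r ↔
      Admissible α η π ∧ (∀ q, win η ⊤ q π ≤ K) ∧ fLe η π ≤ r ∧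
        (fLe η π = r → bar η ∉ π → ∃ q, K ≤ win η (bar (2 * η) : OPart) q π) ∧
        ∀ s, TypeCond η K s ((r : ℤ) - 1) π := by
  have e : π ∈ setB0 α η (K + 1) r ↔ π ∈ setB α η (K + 1) r ∧
      (fLe η π = r → bar η ∉ π →
        ∃ i, ∃ _ : i < π.length, π[i] < bar (2 * η) ∧ IsBand η K π i) ∧
      ∀ i, IsBand η K π i → BandCongr η K ((r : ℤ) - 1) π i := Iff.rfl
  rw [e, mem_setB_iff, and_assoc, and_assoc]
  refine and_congr_right fun h => and_congr_right fun hw => and_congr_right fun _ => ?_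
  rw [forall_bandCongr_iff hη hK h hw, ← exists_isBand_iff (by omega) h.1.1]
  simp only [WithTop.coe_lt_coe]

/-! ### Effect of a single part on the statistics -/

theorem Admissible.of_perm_cons {lam : ℕ} {α : Fin lam → ℕ} {η : ℕ} {x : OPart}
    {π μ : List OPart} (h : Admissible α η π) (hp : π.Perm (x :: μ))
    (hμ : μ.Pairwise (· ≥ ·)) : Admissible α η μ := by
  have hsub : ∀ p ∈ μ, p ∈ π := fun p hpμ => hp.mem_iff.2 (List.mem_cons_of_mem _ hpμ)
  refine ⟨⟨hμ, fun p hpμ => h.1.2.1 p (hsub p hpμ), fun p hpμ ho => ?_⟩,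
    fun p hpμ => h.2.1 p (hsub p hpμ), fun p hpμ => h.2.2 p (hsub p hpμ)⟩
  have h1 := h.1.2.2 p (hsub p hpμ) ho
  rw [hp.count_eq, List.count_cons] at h1
  have := List.count_pos_iff.2 hpμ
  omega

theorem Admissible.perm_cons {lam : ℕ} {α : Fin lam → ℕ} {η : ℕ} {x : OPart}
    {π μ : List OPart} (h : Admissible α η μ) (hp : π.Perm (x :: μ))
    (hπ : π.Pairwise (· ≥ ·)) (hx0 : 0 < x.size) (hx : η ∣ x.size)
    (hxμ : x.overlined = true → x ∉ μ) : Admissible α η π := by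
  have hsub : ∀ p ∈ π, p = x ∨ p ∈ μ := fun p hpπ => by simpa using hp.mem_iff.1 hpπ
  refine ⟨⟨hπ, fun p hpπ => ?_, fun p hpπ ho => ?_⟩, fun p hpπ => ?_, fun p hpπ ho => ?_⟩
  · rcases hsub p hpπ with rfl | h'
    · exact hx0
    · exact h.1.2.1 p h'
  · rw [hp.count_eq, List.count_cons]
    by_cases hpx : p = x
    · subst hpx
      rw [List.count_eq_zero_of_not_mem (hxμ ho)]
      simp
    · have : ¬ x = p := fun h => hpx h.symm
      simp [this, h.1.2.2 p ((hsub p hpπ).resolve_left hpx) ho]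
  · rcases hsub p hpπ with rfl | h'
    · exact Or.inl (Nat.modEq_zero_iff_dvd.2 hx)
    · exact h.2.1 p h'
  · rcases hsub p hpπ with rfl | h'
    · exact hx
    · exact h.2.2 p h' ho

/-- Compared with `typ_cons_bar` at s = t - 1: only the non-overlined part changes the parity there,
so the overlining can be chosen to satisfy the congruence. -/
theorem typ_cons_plain {η s t m : ℕ} (hη : 0 < η) (μ : List OPart) :
    typ η s m (plain (t * η) :: μ) = typ η s m μ + if t = s + 1 then 1 else 0 := by
  have : t * η = (s + 1) * η ↔ t = s + 1 := Nat.mul_left_inj hη.ne'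
  unfold typ
  simp only [List.countP_cons, eq_plain_iff, overlined_plain, size_plain, this]
  split_ifs <;> simp_all
  ring

theorem typ_cons_bar {η s t m : ℕ} (hη : 0 < η) (μ : List OPart) :
    typ η s m (bar (t * η) :: μ) = typ η s m μ + if s + 1 < t then 1 else 0 := by
  have : (s + 1) * η < t * η ↔ s + 1 < t := Nat.mul_lt_mul_right hη
  unfold typ
  simp only [List.countP_cons, eq_plain_iff, overlined_bar, size_bar, this]
  split_ifs <;> simp_all
  ring

theorem fLe_cons {η : ℕ} (x : OPart) (μ : List OPart) :
    fLe η (x :: μ) = fLe η μ + if x ≤ plain η then 1 else 0 := by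
  simp [fLe, List.countP_cons]

theorem fLe_perm {η : ℕ} {π μ : List OPart} (h : π.Perm μ) : fLe η π = fLe η μ := h.countP_eq _

/-- If `[(s+1)η, (s+2)η]` contains exactly `K` parts then two adjacent types agree. -/
theorem typ_succ_modEq {η K s : ℕ} {π : List OPart} (hη : 0 < η)
    (hpl : ∀ p ∈ π, p.overlined = false → η ∣ p.size)
    (h : win η ⊤ (plain ((s + 1) * η)) π = K) :
    typ η (s + 1) K π ≡ typ η s K π [ZMOD 2] := by
  -- By this identity the two types differ by twice the number of non-overlined (s+2)η and of
  -- overlined non-multiples of η between (s+1)η and (s+2)η.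
  have key : win η ⊤ (plain ((s + 1) * η)) π +
      π.countP (fun p => p.overlined = true ∧ ¬ η ∣ p.size ∧ p.size < (s + 1) * η) +
      π.countP (fun p => p.overlined = true ∧ η ∣ p.size ∧ (s + 1 + 1) * η < p.size) =
      π.countP (fun p => p = plain ((s + 1) * η)) +
      π.countP (fun p => p = plain ((s + 1 + 1) * η)) +
      π.countP (fun p => p.overlined = true ∧ ¬ η ∣ p.size ∧ p.size < (s + 1 + 1) * η) +
      π.countP (fun p => p.overlined = true ∧ η ∣ p.size ∧ (s + 1) * η < p.size) := by
    clear h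
    induction π with
    | nil => simp [win]
    | cons a π ih =>
      have ih := ih fun p hp => hpl p (by simp [hp])
      have ha := hpl a (by simp)
      rw [win_cons]
      simp only [List.countP_cons, decide_eq_true_eq]
      have : (if plain ((s + 1) * η) ≤ a ∧ Fits η a (plain ((s + 1) * η)) ∧
            (a : WithTop OPart) < ⊤ then 1 else 0) +
          (if a.overlined = true ∧ ¬ η ∣ a.size ∧ a.size < (s + 1) * η then 1 else 0) +
          (if a.overlined = true ∧ η ∣ a.size ∧ (s + 1 + 1) * η < a.size then 1 else 0) =
          (if a = plain ((s + 1) * η) then 1 else 0) +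
          (if a = plain ((s + 1 + 1) * η) then 1 else 0) +
          (if a.overlined = true ∧ ¬ η ∣ a.size ∧ a.size < (s + 1 + 1) * η then 1 else 0) +
          (if a.overlined = true ∧ η ∣ a.size ∧ (s + 1) * η < a.size then 1 else 0) := by
        have e2 : (s + 1 + 1) * η = (s + 1) * η + η := by ring
        have hd1 := fun h : η ∣ a.size => le_or_le_of_dvd h (s + 1)
        have hd2 : ¬ η ∣ a.size → a.size ≠ (s + 1) * η + η := by
          rintro hp h'
          exact hp ⟨s + 1 + 1, by rw [h', ← e2, mul_comm]⟩
        have hd3 : ¬ η ∣ a.size → a.size ≠ (s + 1) * η := by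
          rintro hp h'
          exact hp ⟨s + 1, by rw [h', mul_comm]⟩
        simp only [le_iff_key, fits_iff, key_plain, eq_plain_iff, e2, WithTop.coe_lt_top]
        rcases key_cases a with ⟨o, k⟩ | ⟨o, k⟩ <;> by_cases hd : η ∣ a.size
        · have := hd1 hd
          simp only [o, k, hd]
          simp
          split_ifs <;> omega
        · have := hd2 hd
          have := hd3 hd
          simp only [o, k, hd]
          simp
          split_ifs <;> omega
        · have := hd1 hd
          simp only [o, k, hd]
          simp
          split_ifs <;> omega
        · exact absurd (ha o) hd
      omega
  unfold typ
  rw [Int.ModEq]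
  push_cast
  rw [h] at key
  have e : ((s : ℤ) + 1) * K = s * K + K := by ring
  rw [e]
  omega

theorem mem_setB0Gt_iff {lam : ℕ} {α : Fin lam → ℕ} {η K r s : ℕ} {π : List OPart}
    (hK : lam < K) :
    π ∈ setB0Gt α η (K + 1) r (s + 1) ↔ π ∈ setB0 α η (K + 1) r ∧
      (∀ p ∈ π, p.overlined = true → η ∣ p.size → (s + 1) * η < p.size) ∧
      ∀ q, win η (bar ((s + 2) * η) : OPart) q π < K := by
  have e : π ∈ setB0Gt α η (K + 1) r (s + 1) ↔ π ∈ setB0 α η (K + 1) r ∧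
      (bar ((s + 1) * η) : WithTop OPart) < sPart η π ∧
      (bar ((s + 2) * η) : WithTop OPart) ≤ gPart η (K + 1) π := Iff.rfl
  rw [e, lt_sPart_iff]
  refine and_congr_right fun h => ?_
  rw [le_gPart_iff (by omega) h.1.1.1]

theorem mem_setB0Eq_iff {lam : ℕ} {α : Fin lam → ℕ} {η K r s : ℕ} {π : List OPart}
    (hK : lam < K) :
    π ∈ setB0Eq α η (K + 1) r (s + 1) ↔ π ∈ setB0 α η (K + 1) r ∧
      (((bar ((s + 1) * η) ∈ π ∧
          ∀ p ∈ π, p.overlined = true → η ∣ p.size → (s + 1) * η ≤ p.size) ∧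
        ∀ q, win η (bar ((s + 1) * η) : OPart) q π < K) ∨
      ((∀ p ∈ π, p.overlined = true → η ∣ p.size → (s + 1) * η < p.size) ∧
        (∀ q, win η (plain ((s + 1) * η) : OPart) q π < K) ∧
        ∃ q, K ≤ win η (bar ((s + 2) * η) : OPart) q π)) := by
  have e : π ∈ setB0Eq α η (K + 1) r (s + 1) ↔ π ∈ setB0 α η (K + 1) r ∧
      ((sPart η π = bar ((s + 1) * η) ∧
          (bar ((s + 1) * η) : WithTop OPart) ≤ gPart η (K + 1) π) ∨
        ((bar ((s + 1) * η) : WithTop OPart) < sPart η π ∧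
          (plain ((s + 1) * η) : WithTop OPart) ≤ gPart η (K + 1) π ∧
          gPart η (K + 1) π < (bar ((s + 2) * η) : WithTop OPart))) := Iff.rfl
  rw [e, lt_sPart_iff, sPart_eq_iff (Dvd.intro_left _ rfl)]
  refine and_congr_right fun h => ?_
  rw [le_gPart_iff (by omega) h.1.1.1, le_gPart_iff (by omega) h.1.1.1,
    gPart_lt_iff (by omega) h.1.1.1]

/-- The condition under which a non-overlined part `(s + 1) η` has to be inserted. -/
def InsertsPlain (η K r s : ℕ) (μ : List OPart) : Prop :=
  (∃ q, plain (s * η) ≤ q ∧ q ≤ bar ((s + 1) * η) ∧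
    K ≤ win η (bar ((s + 2) * η) : OPart) q μ + 1) ∧ ¬ typ η s K μ ≡ (r : ℤ) - 1 [ZMOD 2]

/-! ### Comparison of windows near (s+1)η -/

section Windows

variable {η s : ℕ} {c : WithTop OPart} {q : OPart} {π : List OPart}

/-- Only a non-overlined part can fit with equality, and its key is odd; so no part of the window
reaches overlined (s+2)η and the cut-off costs nothing. -/
theorem win_le_of_le_bar_succ (h : q ≤ bar ((s + 1) * η)) :
    win η c q π ≤ win η (bar ((s + 2) * η) : OPart) q π := by
  apply win_le_of_imp
  intro p _ h1 h2 _
  refine ⟨h1, h2, ?_⟩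
  have e : (s + 2) * η = (s + 1) * η + η := by ring
  rw [WithTop.coe_lt_coe]
  simp only [le_iff_key, lt_iff_key, fits_iff, key_bar, e] at *
  rcases key_cases p with ⟨o, k⟩ | ⟨o, k⟩ <;> simp [o] at h2 <;> omega

theorem win_le_of_lt_plain (h : q < plain (s * η)) :
    win η c q π ≤ win η (bar ((s + 1) * η) : OPart) q π := by
  apply win_le_of_imp
  intro p _ h1 h2 _
  refine ⟨h1, h2, ?_⟩
  have e : (s + 1) * η = s * η + η := by ring
  rw [WithTop.coe_lt_coe]
  simp only [le_iff_key, lt_iff_key, fits_iff, key_bar, key_plain, e] at *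
  rcases key_cases p with ⟨o, k⟩ | ⟨o, k⟩ <;> simp [o] at h2 <;> omega

/-- Below the cut-off every part from overlined (s+1)η on fits that part strictly, so lowering q to
it loses nothing. -/
theorem win_le_bar (h : bar ((s + 1) * η) ≤ q) :
    win η (bar ((s + 2) * η) : OPart) q π ≤
      win η (bar ((s + 2) * η) : OPart) (bar ((s + 1) * η)) π := by
  apply win_le_of_imp
  intro p _ h1 h2 h3
  have e : (s + 2) * η = (s + 1) * η + η := by ring
  rw [WithTop.coe_lt_coe] at *
  refine ⟨h.trans h1, ?_, h3⟩
  simp only [le_iff_key, lt_iff_key, fits_iff, key_bar, e] at *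
  omega

theorem win_le_plain (h : plain ((s + 1) * η) ≤ q) :
    win η (bar ((s + 2) * η) : OPart) q π ≤
      win η (bar ((s + 2) * η) : OPart) (plain ((s + 1) * η)) π := by
  apply win_le_of_imp
  intro p _ h1 h2 h3
  have e : (s + 2) * η = (s + 1) * η + η := by ring
  rw [WithTop.coe_lt_coe] at *
  refine ⟨h.trans h1, ?_, h3⟩
  simp only [le_iff_key, lt_iff_key, fits_iff, key_bar, key_plain, e] at *
  omega

theorem bar_fits_iff :
    Fits η (bar ((s + 1) * η)) q ↔ plain (s * η) ≤ q := by
  have e : (s + 1) * η = s * η + η := by ring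
  simp only [le_iff_key, fits_iff, key_bar, key_plain, e, overlined_bar] at *
  simp
  omega

theorem plain_fits_iff :
    Fits η (plain ((s + 1) * η)) q ↔ plain (s * η) ≤ q := by
  have e : (s + 1) * η = s * η + η := by ring
  simp only [le_iff_key, fits_iff, key_plain, e, overlined_plain] at *
  simp
  omega

end Windows

variable {lam : ℕ} {α : Fin lam → ℕ} {η K r s : ℕ} {π μ : List OPart}

theorem coe_bar_le_coe_bar {m n : ℕ} (h : m ≤ n) :
    (bar m : WithTop OPart) ≤ (bar n : OPart) :=
  WithTop.coe_le_coe.2 (bar_le_iff.2 h)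

theorem coe_bar_le_coe_plain {m n : ℕ} (h : m ≤ n) :
    (bar m : WithTop OPart) ≤ (plain n : OPart) :=
  WithTop.coe_le_coe.2 (bar_le_iff.2 h)

theorem win_perm_cons {x : OPart} (hp : π.Perm (x :: μ)) (c : WithTop OPart) (q : OPart) :
    win η c q π =
      win η c q μ + if q ≤ x ∧ Fits η x q ∧ (x : WithTop OPart) < c then 1 else 0 := by
  rw [win_perm hp, win_cons]

theorem win_le_of_perm_cons {x : OPart} (hp : π.Perm (x :: μ)) (c : WithTop OPart) (q : OPart) :
    win η c q μ ≤ win η c q π := by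
  rw [win_perm_cons hp]; omega

/-! ### Removing a part (s+1)η -/

/-- Equality would require, by condition (a), an overlined η or a band starting below overlined 2η;
both are excluded. -/
theorem fLe_lt_of_mem_setB0 (hη : 0 < η) (hK : lam < K) (h : μ ∈ setB0 α η (K + 1) r)
    (hs : ∀ p ∈ μ, p.overlined = true → η ∣ p.size → (s + 1) * η < p.size)
    (hg : ∀ q, win η (bar ((s + 2) * η) : OPart) q μ < K) : fLe η μ < r := by
  obtain ⟨-, -, hf, hr, -⟩ := (mem_setB0_iff hη hK).1 h
  refine lt_of_le_of_ne hf fun he => ?_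
  obtain ⟨q, hq⟩ := hr he fun hb => by
    have := hs _ hb rfl (by simp)
    simp only [size_bar] at this
    nlinarith
  have h1 := hg q
  have h2 := win_mono (η := η) (coe_bar_le_coe_bar (Nat.mul_le_mul_right η (Nat.le_add_left 2 s)))
    q μ
  omega

/-- For s = 0 the removed part was itself counted; for s > 0 both alternatives in condition (a) fail
already in π. -/
theorem fLe_lt_of_perm_cons (hη : 0 < η) (hK : lam < K) (h : π ∈ setB0 α η (K + 1) r) {x : OPart}
    (hp : π.Perm (x :: μ)) (hx : s = 0 → x ≤ plain η)
    (hs : ∀ p ∈ π, p.overlined = true → η ∣ p.size → (s + 1) * η ≤ p.size)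
    (hg : ∀ q, win η (bar ((s + 1) * η) : OPart) q π < K) : fLe η μ < r := by
  obtain ⟨-, -, hf, hr, -⟩ := (mem_setB0_iff hη hK).1 h
  have hc := (fLe_perm (η := η) hp).trans (fLe_cons x μ)
  rcases Nat.eq_zero_or_pos s with h0 | h0
  · rw [if_pos (hx h0)] at hc
    omega
  · refine lt_of_le_of_ne (by omega) fun he => ?_
    obtain ⟨q, hq⟩ := hr (by omega) fun hb => by
      have := hs _ hb rfl (by simp)
      simp only [size_bar] at this
      nlinarith
    have h1 := hg q
    have h2 := win_mono (η := η)
      (coe_bar_le_coe_bar (Nat.mul_le_mul_right η (by omega : 2 ≤ s + 1))) q π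
    omega

/-- Removing a part below all relevant bands. -/
theorem mem_setB0_of_perm_cons (hη : 0 < η) (hK : lam < K) (h : π ∈ setB0 α η (K + 1) r)
    {x : OPart} (hp : π.Perm (x :: μ)) (hμ : μ.Pairwise (· ≥ ·))
    (ht : ∀ s', s < s' → typ η s' K π = typ η s' K μ) (hlt : fLe η μ < r)
    (hg : ∀ q, win η (bar ((s + 2) * η) : OPart) q μ < K) : μ ∈ setB0 α η (K + 1) r := by
  obtain ⟨hA, hw, hf, hr, hT⟩ := (mem_setB0_iff hη hK).1 h
  refine (mem_setB0_iff hη hK).2 ⟨hA.of_perm_cons hp hμ,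
    fun q => (win_le_of_perm_cons hp _ q).trans (hw q), hlt.le, fun h => by omega, ?_⟩
  intro s' q hq hKq
  by_cases hss : s < s'
  · rw [← ht s' hss]
    exact hT s' q hq (hKq.trans (win_le_of_perm_cons hp _ q))
  · have h1 := hg q
    have h2 := win_mono (η := η)
      (coe_bar_le_coe_bar (Nat.mul_le_mul_right η (by omega : s' + 2 ≤ s + 2))) q μ
    omega

theorem remove_bar (hη : 0 < η) (hK : lam < K) (h : π ∈ setB0 α η (K + 1) r)
    (hp : π.Perm (bar ((s + 1) * η) :: μ)) (hμ : μ.Pairwise (· ≥ ·))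
    (hs : ∀ p ∈ π, p.overlined = true → η ∣ p.size → (s + 1) * η ≤ p.size)
    (hg : ∀ q, win η (bar ((s + 1) * η) : OPart) q π < K) :
    μ ∈ setB0Gt α η (K + 1) r (s + 1) ∧ ¬ InsertsPlain η K r s μ := by
  obtain ⟨hA, hw, hf, hr, hT⟩ := (mem_setB0_iff hη hK).1 h
  have hlt : bar ((s + 1) * η) < bar ((s + 2) * η) := by
    rw [bar_lt_iff rfl, size_bar]
    nlinarith
  have hwin : ∀ c q, plain (s * η) ≤ q → q ≤ bar ((s + 1) * η) →
      (bar ((s + 1) * η) : WithTop OPart) < c → win η c q π = win η c q μ + 1 := by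
    intro c q h1 h2 h3
    rw [win_perm_cons hp, if_pos ⟨h2, bar_fits_iff.2 h1, h3⟩]
  have hplain : plain (s * η) ≤ bar ((s + 1) * η) := by
    rw [le_iff_key, key_plain, key_bar]
    nlinarith
  -- Windows through the removed part drop below K. Those starting below non-overlined sη end below
  -- overlined (s+1)η and are covered by `hg`; those starting higher are dominated by the one at
  -- overlined (s+1)η.
  have hg' : ∀ q, win η (bar ((s + 2) * η) : OPart) q μ < K := by
    intro q
    have main : ∀ q, plain (s * η) ≤ q → q ≤ bar ((s + 1) * η) →
        win η (bar ((s + 2) * η) : OPart) q μ < K := by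
      intro q h1 h2
      have h3 := hwin ⊤ q h1 h2 (WithTop.coe_lt_top _)
      have h4 := hw q
      have h5 := win_mono (η := η) (le_top (a := ((bar ((s + 2) * η) : OPart) : WithTop OPart))) q μ
      omega
    rcases le_total q (bar ((s + 1) * η)) with h2 | h2
    · rcases le_or_gt (plain (s * η)) q with h1 | h1
      · exact main q h1 h2
      · exact ((win_le_of_lt_plain h1).trans (win_le_of_perm_cons hp _ q)).trans_lt (hg q)
    · exact (win_le_bar h2).trans_lt (main _ hplain le_rfl)
  have hlt' : fLe η μ < r := by
    refine fLe_lt_of_perm_cons hη hK h hp (fun h0 => ?_) hs hg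
    rw [h0, le_iff_key, key_bar, key_plain]
    omega
  have ht : ∀ s', s ≤ s' → typ η s' K π = typ η s' K μ := by
    intro s' hs'
    rw [typ_congr hp, typ_cons_bar hη, if_neg (by omega), add_zero]
  refine ⟨(mem_setB0Gt_iff hK).2 ⟨mem_setB0_of_perm_cons hη hK h hp hμ
    (fun s' hs' => ht s' hs'.le) hlt' hg', ?_, hg'⟩, ?_⟩
  · intro p hpμ h1 h2
    refine lt_of_le_of_ne (hs p (hp.mem_iff.2 (List.mem_cons_of_mem _ hpμ)) h1 h2) fun he => ?_
    have hpe : p = bar ((s + 1) * η) := eq_bar_iff.2 ⟨h1, he.symm⟩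
    subst hpe
    have h3 := hA.1.2.2 _ (hp.mem_iff.2 (List.mem_cons_of_mem _ hpμ)) rfl
    rw [hp.count_eq, List.count_cons_self] at h3
    have := List.count_pos_iff.2 hpμ
    omega
  · rintro ⟨⟨q, h1, h2, h3⟩, h4⟩
    apply h4
    rw [← ht s le_rfl]
    exact hT s q h1 (by rw [hwin _ q h1 h2 (WithTop.coe_lt_coe.2 hlt)]; exact h3)

theorem remove_plain (hη : 0 < η) (hK : lam < K) (h : π ∈ setB0 α η (K + 1) r)
    (hp : π.Perm (plain ((s + 1) * η) :: μ)) (hμ : μ.Pairwise (· ≥ ·))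
    (hs : ∀ p ∈ π, p.overlined = true → η ∣ p.size → (s + 1) * η < p.size)
    (hg : ∀ q, win η (plain ((s + 1) * η) : OPart) q π < K)
    (hg' : ∃ q, K ≤ win η (bar ((s + 2) * η) : OPart) q π) :
    μ ∈ setB0Gt α η (K + 1) r (s + 1) ∧ InsertsPlain η K r s μ := by
  obtain ⟨hA, hw, hf, hr, hT⟩ := (mem_setB0_iff hη hK).1 h
  have hlt : plain ((s + 1) * η) < bar ((s + 2) * η) := by
    rw [lt_iff_key, key_bar, key_plain]
    nlinarith
  have hwin : ∀ c q, plain (s * η) ≤ q → q ≤ plain ((s + 1) * η) →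
      (plain ((s + 1) * η) : WithTop OPart) < c → win η c q π = win η c q μ + 1 := by
    intro c q h1 h2 h3
    rw [win_perm_cons hp, if_pos ⟨h2, plain_fits_iff.2 h1, h3⟩]
  have hplain : plain (s * η) ≤ plain ((s + 1) * η) := by
    rw [le_iff_key, key_plain, key_plain]
    nlinarith
  have hplain' : plain (s * η) ≤ bar ((s + 1) * η) := by
    rw [le_iff_key, key_plain, key_bar]
    nlinarith
  have hbp : bar ((s + 1) * η) ≤ plain ((s + 1) * η) := bar_le_iff.2 le_rfl
  have hgb : ∀ q, win η (bar ((s + 1) * η) : OPart) q π < K := fun q =>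
    (win_mono (coe_bar_le_coe_plain le_rfl) q π).trans_lt (hg q)
  have hgμ : ∀ q, win η (bar ((s + 2) * η) : OPart) q μ < K := by
    intro q
    have main : ∀ q, plain (s * η) ≤ q → q ≤ plain ((s + 1) * η) →
        win η (bar ((s + 2) * η) : OPart) q μ < K := by
      intro q h1 h2
      have h3 := hwin ⊤ q h1 h2 (WithTop.coe_lt_top _)
      have h4 := hw q
      have h5 := win_mono (η := η) (le_top (a := ((bar ((s + 2) * η) : OPart) : WithTop OPart))) q μ
      omega
    rcases le_total q (plain ((s + 1) * η)) with h2 | h2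
    · rcases le_or_gt (plain (s * η)) q with h1 | h1
      · exact main q h1 h2
      · exact ((win_le_of_lt_plain h1).trans (win_le_of_perm_cons hp _ q)).trans_lt (hgb q)
    · exact (win_le_plain h2).trans_lt (main _ hplain le_rfl)
  have hlt' : fLe η μ < r := by
    refine fLe_lt_of_perm_cons hη hK h hp (fun h0 => ?_) (fun p hp h1 h2 => (hs p hp h1 h2).le) hgb
    rw [h0, le_iff_key, key_plain, key_plain]
    omega
  have ht : ∀ s', s < s' → typ η s' K π = typ η s' K μ := by
    intro s' hs'
    rw [typ_congr hp, typ_cons_plain hη, if_neg (by omega), add_zero]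
  refine ⟨(mem_setB0Gt_iff hK).2 ⟨mem_setB0_of_perm_cons hη hK h hp hμ ht hlt' hgμ, ?_, hgμ⟩, ?_⟩
  · exact fun p hpμ h1 h2 => hs p (hp.mem_iff.2 (List.mem_cons_of_mem _ hpμ)) h1 h2
  · obtain ⟨q, hq⟩ := hg'
    -- The full window can be chosen to contain the removed part.
    obtain ⟨q, hq1, hq2, hq⟩ : ∃ q, plain (s * η) ≤ q ∧ q ≤ bar ((s + 1) * η) ∧
        K ≤ win η (bar ((s + 2) * η) : OPart) q π := by
      rcases le_total q (bar ((s + 1) * η)) with h2 | h2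
      · refine ⟨q, ?_, h2, hq⟩
        by_contra h1
        have := hgb q
        have := win_le_of_lt_plain (π := π) (c := (bar ((s + 2) * η) : OPart)) (not_le.1 h1)
        omega
      · exact ⟨_, hplain', le_rfl, hq.trans (win_le_bar h2)⟩
    refine ⟨⟨q, hq1, hq2, ?_⟩, ?_⟩
    · rwa [hwin _ q hq1 (hq2.trans hbp) (WithTop.coe_lt_coe.2 hlt)] at hq
    · have h1 := hT s q hq1 hq
      rw [typ_congr hp, typ_cons_plain hη, if_pos rfl] at h1
      intro h2
      rw [Int.ModEq] at h1 h2
      omega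

/-! ### Inserting a part (s+1)η -/

theorem fLe_of_perm_cons {x : OPart} (hη : 0 < η) (hK : lam < K)
    (h : μ ∈ setB0Gt α η (K + 1) r (s + 1)) (hp : π.Perm (x :: μ)) (hx : x.size = (s + 1) * η) :
    fLe η π ≤ r ∧ (fLe η π = r → s = 0) := by
  obtain ⟨hμ, hs, hg⟩ := (mem_setB0Gt_iff hK).1 h
  have h1 := fLe_lt_of_mem_setB0 hη hK hμ hs hg
  have hc := (fLe_perm (η := η) hp).trans (fLe_cons x μ)
  constructor
  · split_ifs at hc <;> omega
  · intro he
    by_contra h0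
    rw [if_neg] at hc
    · omega
    · have := key_cases x
      rw [le_iff_key, key_plain]
      have : 0 < s * η := Nat.mul_pos (Nat.pos_of_ne_zero h0) hη
      have : (s + 1) * η = s * η + η := by ring
      omega

theorem insert_bar (hη : 0 < η) (hK : lam < K) (h : μ ∈ setB0Gt α η (K + 1) r (s + 1))
    (hN : ¬ InsertsPlain η K r s μ) (hp : π.Perm (bar ((s + 1) * η) :: μ))
    (hπ : π.Pairwise (· ≥ ·)) : π ∈ setB0Eq α η (K + 1) r (s + 1) := by
  obtain ⟨hμ, hs, hg⟩ := (mem_setB0Gt_iff hK).1 h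
  obtain ⟨hA, hw, hf, hr, hT⟩ := (mem_setB0_iff hη hK).1 hμ
  obtain ⟨hf1, hf2⟩ := fLe_of_perm_cons hη hK h hp rfl
  have hbm : bar ((s + 1) * η) ∈ π := hp.mem_iff.2 (by simp)
  refine (mem_setB0Eq_iff hK).2 ⟨(mem_setB0_iff hη hK).2 ⟨?_, ?_, hf1, ?_, ?_⟩,
    Or.inl ⟨⟨hbm, ?_⟩, ?_⟩⟩
  · refine hA.perm_cons hp hπ (by simp [hη]) (by simp) fun _ hb => ?_
    exact (hs _ hb rfl (by simp)).ne rfl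
  · intro q
    rw [win_perm_cons hp]
    split_ifs with hq
    · have h1 := win_le_of_le_bar_succ (π := μ) (c := ⊤) hq.1
      have h2 := hg q
      omega
    · exact hw q
  -- Here s = 0, so the new part is the overlined η that condition (a) asks for.
  · intro he hb
    rw [hf2 he, zero_add, one_mul] at hbm
    exact absurd hbm hb
  · intro s' q hq hKq
    rw [win_perm_cons hp] at hKq
    rw [typ_congr hp, typ_cons_bar hη]
    split_ifs at hKq with hx
    · obtain ⟨hx1, hx2, hx3⟩ := hx
      rw [WithTop.coe_lt_coe, bar_lt_iff rfl, size_bar] at hx3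
      have h1 : s + 1 < s' + 2 := lt_of_mul_lt_mul_right hx3 (Nat.zero_le _)
      have h2 := hq.trans hx1
      rw [le_iff_key, key_plain, key_bar] at h2
      have h3 : s' < s + 1 := lt_of_mul_lt_mul_right (a := η) (by omega) (Nat.zero_le _)
      -- Only range s has a window with the new part in it; its parity is right because
      -- `InsertsPlain` fails.
      obtain rfl : s' = s := by omega
      rw [if_neg (by omega), add_zero]
      by_contra hty
      exact hN ⟨⟨q, hq, hx1, hKq⟩, hty⟩
    · by_cases hss : s < s'
      · rw [if_neg (by omega), add_zero]
        exact hT s' q hq hKq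
      · have h1 := hg q
        have h2 := win_mono (η := η)
          (coe_bar_le_coe_bar (Nat.mul_le_mul_right η (by omega : s' + 2 ≤ s + 2))) q μ
        omega
  · intro p hpπ h1 h2
    rcases List.mem_cons.1 (hp.mem_iff.1 hpπ) with rfl | h'
    · exact le_rfl
    · exact (hs p h' h1 h2).le
  · intro q
    rw [win_perm_cons hp, if_neg (fun h => lt_irrefl _ h.2.2), add_zero]
    exact (win_mono (coe_bar_le_coe_bar (Nat.mul_le_mul_right η (by omega))) q μ).trans_lt (hg q)

theorem insert_plain (hη : 0 < η) (hK : lam < K) (h : μ ∈ setB0Gt α η (K + 1) r (s + 1))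
    (hN : InsertsPlain η K r s μ) (hp : π.Perm (plain ((s + 1) * η) :: μ))
    (hπ : π.Pairwise (· ≥ ·)) :
    π ∈ setB0Eq α η (K + 1) r (s + 1) ∧
      ∀ p ∈ π, p.overlined = true → η ∣ p.size → (s + 1) * η < p.size := by
  obtain ⟨hμ, hs, hg⟩ := (mem_setB0Gt_iff hK).1 h
  obtain ⟨hA, hw, hf, hr, hT⟩ := (mem_setB0_iff hη hK).1 hμ
  obtain ⟨hf1, hf2⟩ := fLe_of_perm_cons hη hK h hp rfl
  obtain ⟨⟨q0, hq1, hq2, hq3⟩, hty⟩ := hN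
  have hlt : plain ((s + 1) * η) < bar ((s + 2) * η) := by
    rw [lt_iff_key, key_bar, key_plain]
    nlinarith
  have hbp : bar ((s + 1) * η) ≤ plain ((s + 1) * η) := bar_le_iff.2 le_rfl
  have hq0 : K ≤ win η (bar ((s + 2) * η) : OPart) q0 π := by
    rw [win_perm_cons hp, if_pos ⟨hq2.trans hbp, plain_fits_iff.2 hq1, WithTop.coe_lt_coe.2 hlt⟩]
    exact hq3
  have hsπ : ∀ p ∈ π, p.overlined = true → η ∣ p.size → (s + 1) * η < p.size := by
    intro p hpπ h1 h2
    rcases List.mem_cons.1 (hp.mem_iff.1 hpπ) with rfl | h'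
    · simp at h1
    · exact hs p h' h1 h2
  have hAπ : Admissible α η π :=
    hA.perm_cons hp hπ (by simp [hη]) (by simp) (fun h => by simp at h)
  -- The only window through the new part not controlled by `hg` starts at non-overlined (s+1)η. Had
  -- it K parts already, type s + 1 would be right, and by `typ_succ_modEq` type s as well, contrary
  -- to `hty`.
  have htop : win η ⊤ (plain ((s + 1) * η)) μ < K := by
    refine lt_of_le_of_ne (hw _) fun he => hty ?_
    refine (typ_succ_modEq hη hA.2.2 he).symm.trans ?_
    refine hT (s + 1) _ le_rfl (he.ge.trans ?_)
    apply win_le_of_imp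
    intro p _ h1 h2 _
    refine ⟨h1, h2, ?_⟩
    have e : (s + 1 + 2) * η = (s + 1) * η + 2 * η := by ring
    rw [WithTop.coe_lt_coe, lt_iff_key, key_bar, e]
    rw [fits_iff, key_plain] at h2
    omega
  have hwπ : ∀ q, win η ⊤ q π ≤ K := by
    intro q
    rw [win_perm_cons hp]
    split_ifs with hq
    · rcases le_or_gt q (bar ((s + 1) * η)) with h1 | h1
      · have h1 := win_le_of_le_bar_succ (π := μ) (c := ⊤) h1
        have h2 := hg q
        omega
      · have hqe : q = plain ((s + 1) * η) := by
          apply key_injective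
          have := hq.1
          rw [le_iff_key, key_plain] at this
          rw [lt_iff_key, key_bar] at h1
          rw [key_plain]
          omega
        subst hqe
        omega
    · exact hw q
  have htyπ : typ η s K π ≡ (r : ℤ) - 1 [ZMOD 2] := by
    rw [typ_congr hp, typ_cons_plain hη, if_pos rfl]
    rw [Int.ModEq] at hty ⊢
    omega
  refine ⟨(mem_setB0Eq_iff hK).2 ⟨(mem_setB0_iff hη hK).2 ⟨hAπ, hwπ, hf1, ?_, ?_⟩,
    Or.inr ⟨hsπ, ?_, q0, hq0⟩⟩, hsπ⟩
  · intro he _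
    have h0 := hf2 he
    subst h0
    rw [zero_add] at hq0
    exact ⟨q0, hq0⟩
  · intro s' q hq hKq
    rcases lt_trichotomy s' s with hss | rfl | hss
    · rw [win_perm_cons hp, if_neg] at hKq
      · have h1 := hg q
        have h2 := win_mono (η := η)
          (coe_bar_le_coe_bar (Nat.mul_le_mul_right η (by omega : s' + 2 ≤ s + 2))) q μ
        omega
      · rintro ⟨-, -, h3⟩
        rw [WithTop.coe_lt_coe, lt_iff_key, key_plain, key_bar] at h3
        have := Nat.mul_le_mul_right η (by omega : s' + 2 ≤ s + 1)
        omega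
    · exact htyπ
    · by_cases hx : q ≤ plain ((s + 1) * η)
      · have h1 := hq.trans hx
        rw [le_iff_key, key_plain, key_plain] at h1
        have h2 : s' ≤ s + 1 := le_of_mul_le_mul_right (a := η) (by omega) hη
        obtain rfl : s' = s + 1 := by omega
        obtain rfl := le_antisymm hx hq
        -- The same transfer backwards: the window at non-overlined (s+1)η is now full, so type s +
        -- 1 inherits the parity of type s.
        refine (typ_succ_modEq hη hAπ.2.2 (le_antisymm (hwπ _) ?_)).trans htyπ
        exact hKq.trans (win_mono le_top _ _)
      · rw [typ_congr hp, typ_cons_plain hη, if_neg (by omega), add_zero]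
        rw [win_perm_cons hp, if_neg (fun h => hx h.1)] at hKq
        exact hT s' q hq hKq
  · intro q
    rw [win_perm_cons hp, if_neg (fun h => lt_irrefl _ h.2.2), add_zero]
    exact (win_mono (WithTop.coe_le_coe.2 hlt.le) q μ).trans_lt (hg q)

/-- Otherwise the K-band would contain no multiple of η at all, and then it has at most λ < K parts.
-/
theorem plain_mem_of_isBand (hK : lam < K) (hA : Admissible α η π)
    (hs : ∀ p ∈ π, p.overlined = true → η ∣ p.size → (s + 1) * η < p.size)
    (hg : ∀ q, win η (plain ((s + 1) * η) : OPart) q π < K)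
    (hg' : ∃ q, K ≤ win η (bar ((s + 2) * η) : OPart) q π) : plain ((s + 1) * η) ∈ π := by
  by_contra hmem
  obtain ⟨q, hq⟩ := hg'
  obtain ⟨i, hi, hb, hc, -⟩ := exists_isBand_of_le_win (by omega) hA.1.1 hq
  have h0 : i < π.length := by omega
  have h1 : i + K - 1 < π.length := by omega
  have hx : plain ((s + 1) * η) ≤ π[i] := by
    by_contra hx
    have h2 := hb.le_win hA.1.1 h0 h1 (WithTop.coe_lt_coe.2 (not_le.1 hx))
    have h3 := hg π[i + K - 1]
    omega
  have hw := hb.le_win hA.1.1 h0 h1 hc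
  have e1 : (s + 1) * η = s * η + η := by ring
  have e2 : (s + 2) * η = s * η + η + η := by ring
  have hd1 : ∀ n, η ∣ n → n ≤ s * η ∨ s * η + η ≤ n := fun n hn => le_or_le_of_dvd hn s
  have hd2 : ∀ n, η ∣ n → n ≤ s * η + η ∨ s * η + η + η ≤ n := by
    intro n hn
    have := le_or_le_of_dvd hn (s + 1)
    rwa [e1] at this
  have hxo : π[i] ≠ plain ((s + 1) * η) := fun h => hmem (h ▸ List.getElem_mem h0)
  have hpl := hA.2.2 _ (List.getElem_mem h0)
  -- The first part is strictly larger than non-overlined (s+1)η, so the last exceeds non-overlined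
  -- sη; a multiple of η in the band can then only have size (s+1)η.
  have hy : plain (s * η) < π[i + K - 1] := by
    obtain ⟨_, _, hf⟩ := isBand_iff.1 hb
    have hxo' : π[i].key ≠ (plain ((s + 1) * η)).key := fun h => hxo (key_injective h)
    rw [WithTop.coe_lt_coe] at hc
    simp only [lt_iff_key, le_iff_key, fits_iff, key_plain, key_bar, e1, e2] at *
    rcases key_cases π[i] with ⟨o, k⟩ | ⟨o, k⟩
    · simp [o] at hf
      omega
    · have := hd2 _ (hpl o)
      omega
  have := hA.countP_le π[i + K - 1] (fun p => π[i + K - 1] ≤ p ∧ Fits η p π[i + K - 1] ∧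
    (p : WithTop OPart) < (bar ((s + 2) * η) : OPart)) (by
      rintro p hp ⟨h1, h2, h3⟩
      refine ⟨h1, h2, fun hd => ?_⟩
      have hp2 : p ≠ plain ((s + 1) * η) := fun h => hmem (h ▸ hp)
      have hp3 := hs p hp
      rw [Ne, eq_plain_iff, e1] at hp2
      have h4 := hy.trans_le h1
      rw [WithTop.coe_lt_coe] at h3
      simp only [lt_iff_key, key_plain, key_bar, e1, e2] at h3 h4 hp3
      have := hd1 _ hd
      have := hd2 _ hd
      rcases key_cases p with ⟨o, k⟩ | ⟨o, k⟩
      · have := hp3 o hd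
        omega
      · have : p.size ≠ s * η + η := fun h => hp2 ⟨o, h⟩
        omega)
  unfold win at hw
  omega

open Classical in
/-- Inserts a part `(s + 1) η`, overlined or not. -/
noncomputable def insertPart (η K r s : ℕ) (μ : List OPart) : List OPart :=
  if InsertsPlain η K r s μ then μ.orderedInsert (· ≥ ·) (plain ((s + 1) * η))
  else μ.orderedInsert (· ≥ ·) (bar ((s + 1) * η))

/-! ### `reduction` and its inverse -/

theorem weight_perm (h : π.Perm μ) : weight π = weight μ := (h.map _).sum_eq

theorem reduction_spec (hη : 0 < η) (hK : lam < K) (h : π ∈ setB0Eq α η (K + 1) r (s + 1)) :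
    reduction η (s + 1) π ∈ setB0Gt α η (K + 1) r (s + 1) ∧
      insertPart η K r s (reduction η (s + 1) π) = π ∧
      weight (reduction η (s + 1) π) + (s + 1) * η = weight π ∧
      (reduction η (s + 1) π).length + 1 = π.length := by
  have aux : ∀ x ∈ π, x.size = (s + 1) * η → weight (π.erase x) + (s + 1) * η = weight π ∧
      (π.erase x).length + 1 = π.length := by
    intro x hx hsz
    have hp := List.perm_cons_erase hx
    rw [weight_perm hp, hp.length_eq]
    simp [weight, hsz, add_comm]
  obtain ⟨h0, hc⟩ := (mem_setB0Eq_iff hK).1 h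
  have hsort := h0.1.1.1
  unfold reduction
  rcases hc with ⟨hs, hg⟩ | ⟨hs, hg, hg'⟩
  · rw [if_pos ((sPart_eq_iff (by simp)).2 hs)]
    obtain ⟨h1, h2⟩ := remove_bar hη hK h0 (List.perm_cons_erase hs.1)
      (hsort.sublist List.erase_sublist) hs.2 hg
    refine ⟨h1, ?_, aux _ hs.1 rfl⟩
    rw [insertPart, if_neg h2, List.orderedInsert_erase _ _ hs.1 hsort]
  · rw [if_neg (fun hb => (hs _ ((sPart_eq_iff (by simp)).1 hb).1 rfl (by simp)).ne rfl)]
    have hm := plain_mem_of_isBand hK ((mem_setB0_iff hη hK).1 h0).1 hs hg hg'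
    obtain ⟨h1, h2⟩ := remove_plain hη hK h0 (List.perm_cons_erase hm)
      (hsort.sublist List.erase_sublist) hs hg hg'
    refine ⟨h1, ?_, aux _ hm rfl⟩
    rw [insertPart, if_pos h2, List.orderedInsert_erase _ _ hm hsort]

theorem insertPart_spec (hη : 0 < η) (hK : lam < K) (h : μ ∈ setB0Gt α η (K + 1) r (s + 1)) :
    insertPart η K r s μ ∈ setB0Eq α η (K + 1) r (s + 1) ∧
      reduction η (s + 1) (insertPart η K r s μ) = μ := by
  have hsort : μ.Pairwise (· ≥ ·) := h.1.1.1.1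
  unfold insertPart
  split_ifs with hN
  · obtain ⟨h1, h2⟩ := insert_plain hη hK h hN (List.perm_orderedInsert (· ≥ ·) _ μ)
      (hsort.orderedInsert _ _)
    refine ⟨h1, ?_⟩
    rw [reduction, if_neg (fun hb => (h2 _ ((sPart_eq_iff (by simp)).1 hb).1 rfl (by simp)).ne rfl),
      List.erase_orderedInsert]
  · refine ⟨insert_bar hη hK h hN (List.perm_orderedInsert (· ≥ ·) _ μ)
      (hsort.orderedInsert _ _), ?_⟩
    obtain ⟨-, hs, -⟩ := (mem_setB0Gt_iff hK).1 h
    rw [reduction, if_pos, List.erase_orderedInsert]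
    rw [sPart_eq_iff (by simp)]
    refine ⟨by simp, fun p hp h1 h2 => ?_⟩
    rcases List.mem_orderedInsert _ |>.1 hp with rfl | hp
    · exact le_rfl
    · exact (hs p hp h1 h2).le

/-- K ≥ 2 is needed only here, for (K-1)-bands to be nonempty. No window below overlined (s+2)η
reaches K, so `bandCongr_iff_typ` applies to these bands. -/
theorem augmentation_eq_insertPart (hη : 0 < η) (hK : lam < K) (hK2 : 2 ≤ K)
    (h : μ ∈ setB0Gt α η (K + 1) r (s + 1)) :
    augmentation η (K + 1) r (s + 1) μ = insertPart η K r s μ := by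
  obtain ⟨M, rfl⟩ : ∃ M, K = M + 1 := ⟨K - 1, by omega⟩
  obtain ⟨h0, -, hg⟩ := (mem_setB0Gt_iff hK).1 h
  obtain ⟨hA, -⟩ := (mem_setB0_iff hη hK).1 h0
  have hex : ∀ q, win η (bar ((s + 2) * η) : OPart) q μ ≤ M := fun q => Nat.le_of_lt_succ (hg q)
  -- Passing from K to K - 1 parts lowers the type by s; together with the negation this gives the
  -- summand t = s + 1.
  have htyp : ¬ typ η s (M + 1) μ ≡ (r : ℤ) - 1 [ZMOD 2] ↔
      typ η s M μ ≡ ((s + 1 : ℕ) : ℤ) + r - 1 [ZMOD 2] := by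
    have : typ η s (M + 1) μ = typ η s M μ + s := by
      unfold typ
      push_cast
      ring
    rw [this]
    simp only [Int.ModEq]
    push_cast
    omega
  have hplain : plain (s * η) ≤ bar ((s + 1) * η) := by
    rw [le_iff_key, key_plain, key_bar]
    nlinarith
  unfold augmentation insertPart
  congr 1
  rw [show M + 1 + 1 - 2 = M from rfl, Nat.add_sub_cancel, InsertsPlain, htyp, eq_iff_iff]
  constructor
  · rintro ⟨⟨i, hi⟩, h1, ⟨h2, h3⟩, h4, h5⟩
    simp only at h2 h3 h5
    have hlw := h1.le_win hA.1.1 hi h2 (WithTop.coe_lt_coe.2 h4)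
    refine ⟨?_, (bandCongr_iff_typ hη hA.1.1 hA.2.2 h1 hi h2 h3 h4 hex).1 h5⟩
    rcases le_total μ[i + M - 1] (bar ((s + 1) * η)) with h6 | h6
    · exact ⟨_, h3, h6, Nat.succ_le_succ hlw⟩
    · exact ⟨_, hplain, le_rfl, Nat.succ_le_succ (hlw.trans (win_le_bar h6))⟩
  · rintro ⟨⟨q, h1, h2, h3⟩, h4⟩
    obtain ⟨i, hi, h5, h6, h7⟩ := exists_isBand_of_le_win (by omega) hA.1.1
      (Nat.le_of_succ_le_succ h3)
    have h8 : i + M - 1 < μ.length := by omega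
    refine ⟨⟨i, by omega⟩, h5, ⟨h8, h1.trans h7⟩, WithTop.coe_lt_coe.1 h6, ?_⟩
    exact (bandCongr_iff_typ hη hA.1.1 hA.2.2 h5 (by omega) h8 (h1.trans h7)
      (WithTop.coe_lt_coe.1 h6) hex).2 h4

/-! ### The reduction index -/

theorem natCast_le_withTop_some {m n : ℕ} : (n : WithTop ℕ) ≤ WithTop.some m ↔ n ≤ m :=
  WithTop.coe_le_coe

theorem withTop_some_eq_natCast {m n : ℕ} : WithTop.some m = (n : WithTop ℕ) ↔ m = n :=
  WithTop.coe_inj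

theorem le_map_size_div_iff (hη : 0 < η) {n : ℕ} {X : WithTop OPart} :
    ((n : ℕ) : WithTop ℕ) ≤ X.map (fun p => p.size / η) ↔
      (bar (n * η) : WithTop OPart) ≤ X := by
  induction X using WithTop.recTopCoe with
  | top => simp
  | coe p =>
    rw [WithTop.map_coe, natCast_le_withTop_some, WithTop.coe_le_coe, bar_le_iff]
    exact Nat.le_div_iff_mul_le hη

theorem le_reductionIndex_iff (hη : 0 < η) {k n : ℕ} :
    ((n : ℕ) : WithTop ℕ) ≤ reductionIndex η k π ↔
      (bar (n * η) : WithTop OPart) ≤ sPart η π ∧ (bar (n * η) : WithTop OPart) ≤ gPart η k π := by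
  rw [reductionIndex, le_min_iff, le_map_size_div_iff hη, le_map_size_div_iff hη]

theorem lt_sPart_iff_succ_le (hη : 0 < η) {t : ℕ} :
    (bar (t * η) : WithTop OPart) < sPart η π ↔
      (bar ((t + 1) * η) : WithTop OPart) ≤ sPart η π := by
  rw [lt_sPart_iff, le_sPart_iff]
  refine forall₂_congr fun p _ => forall₂_congr fun _ hd => ?_
  have := le_or_le_of_dvd hd t
  rw [Nat.succ_mul]
  omega

theorem mem_setB0Gt_iff_index (hη : 0 < η) {k t : ℕ} :
    π ∈ setB0Gt α η k r t ↔
      π ∈ setB0 α η k r ∧ ((t + 1 : ℕ) : WithTop ℕ) ≤ reductionIndex η k π := by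
  rw [le_reductionIndex_iff hη, ← lt_sPart_iff_succ_le hη]
  rfl

theorem mem_of_gPart_eq {k : ℕ} {p : OPart} (h : gPart η k π = p) : p ∈ π := by
  unfold gPart at h
  rcases Finset.eq_empty_or_nonempty
    (Finset.univ.filter fun i : Fin π.length => IsBand η (k - 1) π i) with he | hne
  · rw [he] at h
    simp at h
  · obtain ⟨i, -, hi⟩ := Finset.exists_mem_eq_inf _ hne (fun i => (π[i] : WithTop OPart))
    rw [hi, WithTop.coe_inj] at h
    rw [← h]
    exact List.getElem_mem i.2

theorem mem_setB0Eq_iff_index (hη : 0 < η) {k t : ℕ} :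
    π ∈ setB0Eq α η k r t ↔
      π ∈ setB0 α η k r ∧ reductionIndex η k π = ((t : ℕ) : WithTop ℕ) := by
  have e : reductionIndex η k π = ((t : ℕ) : WithTop ℕ) ↔
      ((t : ℕ) : WithTop ℕ) ≤ reductionIndex η k π ∧
        ¬ ((t + 1 : ℕ) : WithTop ℕ) ≤ reductionIndex η k π := by
    cases hX : reductionIndex η k π with
    | top => simp
    | coe m =>
      rw [natCast_le_withTop_some, natCast_le_withTop_some, withTop_some_eq_natCast]
      omega
  rw [e, le_reductionIndex_iff hη, le_reductionIndex_iff hη, ← lt_sPart_iff_succ_le hη]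
  refine and_congr_right fun _ => ?_
  constructor
  · rintro (⟨h1, h2⟩ | ⟨h1, h2, h3⟩)
    · exact ⟨⟨h1.ge, h2⟩, fun h => h.1.ne' h1⟩
    · exact ⟨⟨h1.le, (coe_bar_le_coe_plain le_rfl).trans h2⟩, fun h => h.2.not_gt h3⟩
  · rintro ⟨⟨h1, h2⟩, h3⟩
    rcases h1.eq_or_lt with h | h
    · exact Or.inl ⟨h.symm, h2⟩
    · refine Or.inr ⟨h, ?_, not_le.1 fun h' => h3 ⟨h, h'⟩⟩
      -- A first part equal to overlined tη would be an overlined multiple of η, against s(π) >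
      -- overlined tη. Hence the bound on g improves to non-overlined tη.
      have hne : gPart η k π ≠ (bar (t * η) : OPart) := fun he =>
        (lt_sPart_iff.1 h _ (mem_of_gPart_eq he) rfl (by simp)).ne rfl
      have hlt := lt_of_le_of_ne h2 hne.symm
      cases hg : gPart η k π with
      | top => exact le_top
      | coe p =>
        rw [hg, WithTop.coe_lt_coe, lt_iff_key, key_bar] at hlt
        rw [WithTop.coe_le_coe, le_iff_key, key_plain]
        omega

theorem one_le_reductionIndex (hη : 0 < η) (hK : lam < K) (h : π ∈ setB0 α η (K + 1) r) :
    ((1 : ℕ) : WithTop ℕ) ≤ reductionIndex η (K + 1) π := by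
  have hA := ((mem_setB0_iff hη hK).1 h).1
  rw [le_reductionIndex_iff hη, one_mul, le_sPart_iff, le_gPart_iff (by omega) hA.1.1]
  exact ⟨fun p hp _ hd => Nat.le_of_dvd (hA.1.2.1 p hp) hd, fun q => hA.win_bar_lt hK⟩

theorem reductionIndex_cases (hη : 0 < η) (hK : lam < K) (h : π ∈ setB0 α η (K + 1) r) :
    reductionIndex η (K + 1) π = ⊤ ∨
      ∃ s, reductionIndex η (K + 1) π = ((s + 1 : ℕ) : WithTop ℕ) := by
  have h1 := one_le_reductionIndex hη hK h
  cases hX : reductionIndex η (K + 1) π with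
  | top => exact Or.inl rfl
  | coe m =>
    rw [hX, natCast_le_withTop_some] at h1
    exact Or.inr ⟨m - 1, withTop_some_eq_natCast.2 (by omega)⟩

/-- Without K-bands the congruence is void and the difference condition holds for K; condition (a)
then reduces to f < r, as both of its alternatives are absent. -/
theorem mem_setB1_iff (hη : 0 < η) (hK : lam < K) :
    π ∈ setB1 α η K r ↔ π ∈ setB0 α η (K + 1) r ∧ reductionIndex η (K + 1) π = ⊤ := by
  obtain ⟨M, rfl⟩ : ∃ M, K = M + 1 := ⟨K - 1, by omega⟩
  have hs : sPart η π = ⊤ ↔ ∀ p ∈ π, p.overlined = true → ¬ η ∣ p.size := by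
    simp [sPart, Finset.inf_eq_top_iff]
  have hidx : reductionIndex η (M + 1 + 1) π = ⊤ ↔ sPart η π = ⊤ ∧ gPart η (M + 1 + 1) π = ⊤ := by
    rw [reductionIndex, min_eq_top, WithTop.map_eq_top_iff, WithTop.map_eq_top_iff]
  rw [hidx, hs]
  have hB1 : π ∈ setB1 α η (M + 1) r ↔ π ∈ setB α η (M + 1) r ∧
      (∀ p ∈ π, p.overlined = true → ¬ η ∣ p.size) ∧ fLe η π < r := Iff.rfl
  rw [hB1, mem_setB_iff, mem_setB0_iff hη hK]
  constructor
  · rintro ⟨⟨hA, hw, hf⟩, h1, h2⟩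
    refine ⟨⟨hA, fun q => (hw q).trans (Nat.le_succ M), hf, fun h => by omega, ?_⟩, h1, ?_⟩
    · intro s q _ hq
      have := hw q
      have := win_mono (η := η) (le_top (a := ((bar ((s + 2) * η) : OPart) : WithTop OPart))) q π
      omega
    · rw [← top_le_iff, le_gPart_iff (by omega) hA.1.1]
      exact fun q => Nat.lt_succ_of_le (hw q)
  · rintro ⟨⟨hA, hw, hf, hr, -⟩, h1, h2⟩
    rw [← top_le_iff, le_gPart_iff (by omega) hA.1.1] at h2
    refine ⟨⟨hA, fun q => Nat.le_of_lt_succ (h2 q), hf⟩, h1, lt_of_le_of_ne hf fun he => ?_⟩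
    obtain ⟨q, hq⟩ := hr he fun hb => h1 _ hb rfl (by simp)
    have h3 := h2 q
    have := win_mono (η := η) (le_top (a := ((bar (2 * η) : OPart) : WithTop OPart))) q π
    omega

/-! ### Iterating the reduction -/

/-- The pairs that occur in the procedure defining `Phi`. -/
def IsState (α : Fin lam → ℕ) (η K r : ℕ) (x : List ℕ × List OPart) : Prop :=
  x.1 ∈ setD η ∧ x.2 ∈ setB0 α η (K + 1) r ∧
    ∀ n ∈ x.1, ((n / η + 1 : ℕ) : WithTop ℕ) ≤ reductionIndex η (K + 1) x.2

/-- Undoes the procedure defining `Phi`. -/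
noncomputable def unwind (η K r : ℕ) : List ℕ → List OPart → List OPart
  | [], μ => μ
  | n :: τ, μ => unwind η K r τ (insertPart η K r (n / η - 1) μ)

theorem reductionStep_of_eq_top {k : ℕ} {x : List ℕ × List OPart}
    (h : reductionIndex η k x.2 = ⊤) : reductionStep η k x = x := by
  unfold reductionStep
  rw [h]

theorem reductionStep_of_eq_coe {k t : ℕ} {x : List ℕ × List OPart}
    (h : reductionIndex η k x.2 = ((t : ℕ) : WithTop ℕ)) :
    reductionStep η k x = (x.1.orderedInsert (· ≥ ·) (t * η), reduction η t x.2) := by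
  unfold reductionStep
  rw [h]
  rfl

theorem IsState.lt_mul {x : List ℕ × List OPart} {t : ℕ} (hη : 0 < η) (hx : IsState α η K r x)
    (h : reductionIndex η (K + 1) x.2 = ((t : ℕ) : WithTop ℕ)) : ∀ n ∈ x.1, n < t * η := by
  intro n hn
  have := hx.2.2 n hn
  rw [h] at this
  have : n / η + 1 ≤ t := by exact_mod_cast this
  exact (Nat.div_lt_iff_lt_mul hη).1 (by omega)

theorem IsState.reductionStep_eq {x : List ℕ × List OPart} {t : ℕ} (hη : 0 < η)
    (hx : IsState α η K r x) (h : reductionIndex η (K + 1) x.2 = ((t : ℕ) : WithTop ℕ)) :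
    reductionStep η (K + 1) x = (t * η :: x.1, reduction η t x.2) := by
  rw [reductionStep_of_eq_coe h]
  have hlt := hx.lt_mul hη h
  rcases x with ⟨_ | ⟨n, τ⟩, μ⟩
  · rfl
  · rw [List.orderedInsert_cons_of_le]
    exact (hlt n (by simp)).le

/-- A round that is not idle removes a part and raises the index above the recorded t, so the next
recorded part is strictly larger and goes to the head. -/
theorem IsState.iterate_spec (hη : 0 < η) (hK : lam < K) : ∀ (n : ℕ) (x : List ℕ × List OPart),
    IsState α η K r x → x.2.length ≤ n →
    IsState α η K r ((reductionStep η (K + 1))^[n] x) ∧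
      reductionIndex η (K + 1) ((reductionStep η (K + 1))^[n] x).2 = ⊤ ∧
      unwind η K r ((reductionStep η (K + 1))^[n] x).1 ((reductionStep η (K + 1))^[n] x).2 =
        unwind η K r x.1 x.2 ∧
      ((reductionStep η (K + 1))^[n] x).1.sum + weight ((reductionStep η (K + 1))^[n] x).2 =
        x.1.sum + weight x.2 ∧
      ((reductionStep η (K + 1))^[n] x).1.length + ((reductionStep η (K + 1))^[n] x).2.length =
        x.1.length + x.2.length := by
  intro n
  induction n with
  | zero =>
    intro x hx hn
    have h0 : x.2 = [] := List.length_eq_zero_iff.1 (by omega)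
    refine ⟨hx, ?_, rfl, rfl, rfl⟩
    rw [Function.iterate_zero_apply, h0]
    simp [reductionIndex, sPart, gPart]
  | succ n ih =>
    intro x hx hn
    rcases reductionIndex_cases hη hK hx.2.1 with h | ⟨s, h⟩
    · rw [Function.iterate_fixed (reductionStep_of_eq_top h)]
      exact ⟨hx, h, rfl, rfl, rfl⟩
    · have hEq := (mem_setB0Eq_iff_index hη).2 ⟨hx.2.1, h⟩
      obtain ⟨h1, h2, h3, h4⟩ := reduction_spec hη hK hEq
      obtain ⟨h5, h6⟩ := (mem_setB0Gt_iff_index hη).1 h1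
      have hlt := hx.lt_mul hη h
      have hy : IsState α η K r ((s + 1) * η :: x.1, reduction η (s + 1) x.2) := by
        refine ⟨⟨List.pairwise_cons.2 ⟨hlt, hx.1.1⟩, ?_⟩, h5, ?_⟩
        · intro m hm
          rcases List.mem_cons.1 hm with rfl | hm
          · exact ⟨Nat.mul_pos (Nat.succ_pos s) hη, by simp⟩
          · exact hx.1.2 m hm
        · intro m hm
          refine le_trans ?_ h6
          have : m / η ≤ s + 1 := by
            rcases List.mem_cons.1 hm with rfl | hm
            · rw [Nat.mul_div_cancel _ hη]
            · exact ((Nat.div_lt_iff_lt_mul hη).2 (hlt m hm)).le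
          exact_mod_cast Nat.succ_le_succ this
      rw [Function.iterate_succ_apply, hx.reductionStep_eq hη h]
      obtain ⟨i1, i2, i3, i4, i5⟩ := ih _ hy (by simp only; omega)
      refine ⟨i1, i2, i3.trans ?_, i4.trans ?_, i5.trans ?_⟩
      · simp only [unwind]
        rw [Nat.mul_div_cancel _ hη, Nat.add_sub_cancel, h2]
      · simp only [List.sum_cons]
        omega
      · simp only [List.length_cons]
        omega

/-- The head of τ is its largest part, recorded last and reinserted first. This lowers the index to
s + 1, still above the quotients of the remaining parts. -/
theorem IsState.exists_iterate (hη : 0 < η) (hK : lam < K) : ∀ (τ : List ℕ) (μ : List OPart),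
    IsState α η K r (τ, μ) → unwind η K r τ μ ∈ setB0 α η (K + 1) r ∧
      (reductionStep η (K + 1))^[τ.length] ([], unwind η K r τ μ) = (τ, μ) := by
  intro τ
  induction τ with
  | nil => exact fun μ h => ⟨h.2.1, rfl⟩
  | cons n τ ih =>
    rintro μ ⟨⟨hp, hd⟩, h0, hidx⟩
    simp only at h0 hidx
    rw [List.pairwise_cons] at hp
    obtain ⟨hn, t, rfl⟩ := hd n (by simp)
    obtain ⟨s, rfl⟩ : ∃ s, t = s + 1 :=
      Nat.exists_eq_succ_of_ne_zero (by rintro rfl; simp at hn)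
    have hdiv : η * (s + 1) / η = s + 1 := Nat.mul_div_cancel_left _ hη
    have hGt : μ ∈ setB0Gt α η (K + 1) r (s + 1) := by
      refine (mem_setB0Gt_iff_index hη).2 ⟨h0, ?_⟩
      have := hidx (η * (s + 1)) (by simp)
      rwa [hdiv] at this
    obtain ⟨h1, h2⟩ := insertPart_spec hη hK hGt
    obtain ⟨h3, h4⟩ := (mem_setB0Eq_iff_index hη).1 h1
    have hst : IsState α η K r (τ, insertPart η K r s μ) := by
      refine ⟨⟨hp.2, fun m hm => hd m (by simp [hm])⟩, h3, fun m hm => ?_⟩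
      simp only
      rw [h4]
      have : m / η < s + 1 := (Nat.div_lt_iff_lt_mul hη).2 (by rw [mul_comm]; exact hp.1 m hm)
      exact_mod_cast this
    obtain ⟨i1, i2⟩ := ih _ hst
    have hu : unwind η K r (η * (s + 1) :: τ) μ = unwind η K r τ (insertPart η K r s μ) := by
      rw [unwind, hdiv, Nat.add_sub_cancel]
    rw [hu]
    refine ⟨i1, ?_⟩
    rw [List.length_cons, Function.iterate_succ_apply', i2, hst.reductionStep_eq hη h4]
    simp only [h2, mul_comm]

theorem isState_nil (h : π ∈ setB0 α η (K + 1) r) : IsState α η K r ([], π) :=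
  ⟨⟨List.Pairwise.nil, by simp⟩, h, by simp⟩

theorem Phi_spec (hη : 0 < η) (hK : lam < K) (h : π ∈ setB0 α η (K + 1) r) :
    (Phi η (K + 1) π).1 ∈ setD η ∧ (Phi η (K + 1) π).2 ∈ setB1 α η K r ∧
      unwind η K r (Phi η (K + 1) π).1 (Phi η (K + 1) π).2 = π ∧
      weight π = (Phi η (K + 1) π).1.sum + weight (Phi η (K + 1) π).2 ∧
      π.length = (Phi η (K + 1) π).1.length + (Phi η (K + 1) π).2.length := by
  obtain ⟨h1, h2, h3, h4, h5⟩ := IsState.iterate_spec hη hK π.length _ (isState_nil h) le_rfl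
  refine ⟨h1.1, (mem_setB1_iff hη hK).2 ⟨h1.2.1, h2⟩, h3, ?_, ?_⟩
  · simpa [Phi] using h4.symm
  · simpa [Phi] using h5.symm

theorem Phi_bijOn (hη : 0 < η) (hK : lam < K) :
    Set.BijOn (Phi η (K + 1)) (setB0 α η (K + 1) r) (setD η ×ˢ setB1 α η K r) := by
  refine ⟨fun π h => ⟨(Phi_spec hη hK h).1, (Phi_spec hη hK h).2.1⟩, fun π h π' h' he => ?_, ?_⟩
  · rw [← (Phi_spec hη hK h).2.2.1, ← (Phi_spec hη hK h').2.2.1, he]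
  · rintro ⟨τ, μ⟩ ⟨hτ, hμ⟩
    obtain ⟨h0, h1⟩ := (mem_setB1_iff hη hK).1 hμ
    have hst : IsState α η K r (τ, μ) := ⟨hτ, h0, fun n _ => by simp only; rw [h1]; exact le_top⟩
    obtain ⟨h2, h3⟩ := IsState.exists_iterate hη hK τ μ hst
    refine ⟨_, h2, ?_⟩
    have hlen := (Phi_spec hη hK h2).2.2.2.2
    obtain ⟨-, -, hu, -, h5⟩ := IsState.iterate_spec hη hK _ _ (isState_nil h2) le_rfl
    -- Otherwise the process, stationary after as many rounds as there are parts, would have reached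
    -- (τ, μ) by then, and the count of parts would bound the length of τ.
    have hle : τ.length ≤ (unwind η K r τ μ).length := by
      by_contra hlt
      have h6 := (Function.iterate_add_apply (reductionStep η (K + 1))
        (τ.length - (unwind η K r τ μ).length) (unwind η K r τ μ).length ([], unwind η K r τ μ))
      rw [Nat.sub_add_cancel (by omega), h3, Function.iterate_fixed] at h6
      · rw [← h6] at h5
        simp at h5
        omega
      · exact reductionStep_of_eq_top
          (IsState.iterate_spec hη hK _ _ (isState_nil h2) le_rfl).2.1
    unfold Phi
    rw [← Nat.sub_add_cancel hle, Function.iterate_add_apply, h3,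
      Function.iterate_fixed (reductionStep_of_eq_top h1)]

end Overpartition
open Overpartition in
theorem theorem2p3 {lam : ℕ} (α : Fin lam → ℕ) (η k r : ℕ) (hη : 0 < η)
    (hα_mono : StrictMono α) (hα_pos : ∀ i, 0 < α i) (hα_lt : ∀ i, α i < η)
    (hα_symm : ∀ i, α i = η - α i.rev)
    (hlr : lam ≤ r) (hrk : r < k) (hlk : lam + 1 < k) :
    (∀ t, 1 ≤ t →
      Set.BijOn (reduction η t) (setB0Eq α η k r t) (setB0Gt α η k r t) ∧
      (3 ≤ k →
        Set.BijOn (augmentation η k r t) (setB0Gt α η k r t) (setB0Eq α η k r t) ∧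
        Set.InvOn (augmentation η k r t) (reduction η t)
          (setB0Eq α η k r t) (setB0Gt α η k r t)) ∧
      ∀ π ∈ setB0Eq α η k r t,
        weight (reduction η t π) + t * η = weight π ∧
        (reduction η t π).length + 1 = π.length) ∧
    Set.BijOn (Phi η k) (setB0 α η k r) (setD η ×ˢ setB1 α η (k - 1) r) ∧
    ∀ π ∈ setB0 α η k r,
      weight π = (Phi η k π).1.sum + weight (Phi η k π).2 ∧
      π.length = (Phi η k π).1.length + (Phi η k π).2.length := by
  obtain ⟨K, rfl⟩ : ∃ K, k = K + 1 := ⟨k - 1, by omega⟩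
  have hK : lam < K := by omega
  refine ⟨fun t ht => ?_, Phi_bijOn hη hK, fun π h => (Phi_spec hη hK h).2.2.2⟩
  obtain ⟨s, rfl⟩ : ∃ s, t = s + 1 := ⟨t - 1, by omega⟩
  have hD : Set.MapsTo (reduction η (s + 1)) (setB0Eq α η (K + 1) r (s + 1))
      (setB0Gt α η (K + 1) r (s + 1)) := fun π h => (reduction_spec hη hK h).1
  have hC : Set.MapsTo (insertPart η K r s) (setB0Gt α η (K + 1) r (s + 1))
      (setB0Eq α η (K + 1) r (s + 1)) := fun μ h => (insertPart_spec hη hK h).1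
  have hinv : Set.InvOn (insertPart η K r s) (reduction η (s + 1))
      (setB0Eq α η (K + 1) r (s + 1)) (setB0Gt α η (K + 1) r (s + 1)) :=
    ⟨fun π h => (reduction_spec hη hK h).2.1, fun μ h => (insertPart_spec hη hK h).2⟩
  refine ⟨hinv.bijOn hD hC, fun hk => ?_, fun π h => (reduction_spec hη hK h).2.2⟩
  have heq : Set.EqOn (insertPart η K r s) (augmentation η (K + 1) r (s + 1))
      (setB0Gt α η (K + 1) r (s + 1)) := fun μ h =>
    (augmentation_eq_insertPart hη hK (by omega) h).symm
  refine ⟨(hinv.symm.bijOn hC hD).congr heq, fun π h => ?_, fun μ h => ?_⟩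
  · rw [← heq (hD h)]
    exact hinv.1 h
  · rw [← heq h]
    exact hinv.2 h
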